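/- Let $M$ be a connected (Hausdorff, second countable, finite-dimensional) complex manifold, let $\|\cdot\|$ be a Hermitian metric along the fibres of $TM$, let $d(\cdot,\cdot)$ be the distance induced by it on $M$, and let $k_M$ be the Kobayashi pseudo-distance of $M$. Assume that $M$ is taut (every sequence of holomorphic maps from the unit disc $\mathbb D$ to $M$ has a subsequence which either converges uniformly on compacta to a holomorphic map $\mathbb D\to M$ or is compactly divergent) and that $k_M\in C^1(M\times M\setminus \mathrm{Diag})$. *Definitions.* Let $p\in[1,\infty]$. A *weak holomorphic vector field of order $p$* on $M$ is a function $G:M\times[0,+\infty)\to TM$ with $G(z,t)\in T_zM$ such that: (i) $t\mapsto G(z,t)$ is measurable for all $z\in M$; (ii) $z\mapsto G(z,t)$ is holomorphic for all $t\ge 0$; (iii) for every compact $K\subset M$ and every $T>0$ there is a non-negative $C_{K,T}\in L^p([0,T])$ such that $\|G(z,t)\|\le C_{K,T}(t)$ for almost every $t\in[0,T]$ and all $z\in K$. It is a *Herglotz vector field of order $p$* if moreover $(dk_M)_{(z,w)}(G(z,t),G(w,t))\le 0$ for almost every $t\in[0,+\infty)$ and all $z\neq w$ in $M$. An *evolution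 family of order $p$* on $M$ is a family $(\varphi_{s,t})_{0\le s\le t<+\infty}$ of holomorphic maps $M\to M$ such that: (i) $\varphi_{s,s}=\mathrm{id}_M$; (ii) $\varphi_{s,t}=\varphi_{u,t}\circ\varphi_{s,u}$ for all $0\le s\le u\le t$; (iii) for every compact $K\subset M$ and every $T>0$ there is a non-negative $c_{T,K}\in L^p([0,T])$ such that $$\sup_{z\in K}d(\varphi_{s,t}(z),\varphi_{s,t'}(z))\le\int_{t'}^{t}c_{T,K}(\xi)\,d\xi\qquad\text{for all } 0\le s\le t'\le t\le T.$$ *Statement.* For every evolution family $(\varphi_{s,t})$ of order $\infty$ on $M$ there exists a Herglotz vector field $G$ of order $\infty$ on $M$ such that, for all $s\ge 0$ and all $z\in M$, $$\frac{\partial\varphi_{s,t}(z)}{\partial t}=G(\varphi_{s,t}(z),t)\qquad\text{for a.e. } t\in[s,+\infty).\tag{$*$}$$ Moreover, if $H$ is any weak holomorphic vector field on $M$ (of any order $p\in[1,\infty]$) which satisfies $(*)$ in place of $G$, then for almost every $t\in[0,+\infty)$ one has $G(z,t)=H(z,t)$ for all $z\in M$. -/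

import Mathlib

open Set Filter Topology MeasureTheory
open scoped Manifold ContDiff ENNReal

noncomputable section

namespace Loewner

/-! Throughout, `E` is a finite-dimensional complex normed space and `M` is a complex manifold
modelled on `E`.  The underlying real manifold of `M` is `M` with the same charts and with the
model `𝓘(ℝ, E)`. -/

variable (E : Type*) [NormedAddCommGroup E] [NormedSpace ℂ E]

/-- The Poincaré distance of the unit disc, `artanh |(ζ - η) / (1 - conj ζ * η)|`. -/
def poincareDist (ζ η : ℂ) : ℝ :=
  Real.artanh ‖(ζ - η) / (1 - (starRingEnd ℂ) ζ * η)‖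

section Manifold

variable {M : Type*} [TopologicalSpace M] [ChartedSpace E M]

/-- `f` restricts to a holomorphic map from the open unit disc to `M`. -/
def IsHolomorphicDisc (f : ℂ → M) : Prop :=
  MDifferentiableOn 𝓘(ℂ, ℂ) 𝓘(ℂ, E) f (Metric.ball (0 : ℂ) 1)

/-- The Kobayashi (pseudo-)distance: the infimum of the sums of Poincaré distances
`∑ j < m, ω(ζ j, η j)` over all chains of holomorphic discs `f 0, …, f (m - 1)` in `M` and points
`p 0 = z, p 1, …, p m = w` with `f j (ζ j) = p j` and `f j (η j) = p (j + 1)`.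
(On a connected manifold such chains always exist.) -/
def kobayashiDist (z w : M) : ℝ :=
  sInf {r : ℝ | ∃ (m : ℕ) (p : ℕ → M) (f : ℕ → ℂ → M) (ζ η : ℕ → ℂ),
    p 0 = z ∧ p m = w ∧
    (∀ j < m, IsHolomorphicDisc E (f j) ∧
      ζ j ∈ Metric.ball (0 : ℂ) 1 ∧ η j ∈ Metric.ball (0 : ℂ) 1 ∧
      f j (ζ j) = p j ∧ f j (η j) = p (j + 1)) ∧
    r = ∑ j ∈ Finset.range m, poincareDist (ζ j) (η j)}

/-- Convergence in the compact-open topology, on the open unit disc `𝔻`: for all compact `K ⊆ 𝔻`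
and open `U ⊆ M` with `g(K) ⊆ U`, eventually `f n (K) ⊆ U`. (For a continuous map `g` and any
metric compatible with the topology of `M` this is uniform convergence on compacta.) -/
def DiscTendsto (f : ℕ → ℂ → M) (g : ℂ → M) : Prop :=
  ∀ K ⊆ Metric.ball (0 : ℂ) 1, IsCompact K → ∀ U : Set M, IsOpen U → MapsTo g K U →
    ∀ᶠ n in atTop, MapsTo (f n) K U

/-- The sequence `f` of maps from the open unit disc to `M` is compactly divergent. -/
def DiscCompactlyDivergent (f : ℕ → ℂ → M) : Prop :=
  ∀ K ⊆ Metric.ball (0 : ℂ) 1, IsCompact K → ∀ L : Set M, IsCompact L →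
    ∀ᶠ n in atTop, Disjoint (f n '' K) L

variable (M) in
/-- `M` is taut: the family of all holomorphic maps from the unit disc to `M` is normal, i.e. every
sequence in it has a subsequence which either converges to a holomorphic map, uniformly on
compacta, or is compactly divergent. -/
def IsTaut : Prop :=
  ∀ f : ℕ → ℂ → M, (∀ n, IsHolomorphicDisc E (f n)) →
    ∃ σ : ℕ → ℕ, StrictMono σ ∧
      ((∃ g : ℂ → M, IsHolomorphicDisc E g ∧ DiscTendsto (fun n => f (σ n)) g) ∨
        DiscCompactlyDivergent (fun n => f (σ n)))

variable (M) in
/-- The Kobayashi distance is of class `C^1` (in the real sense) on `M × M` minus the diagonal. -/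
def KobayashiC1 : Prop :=
  ContMDiffOn (𝓘(ℝ, E).prod 𝓘(ℝ, E)) 𝓘(ℝ, ℝ) 1
    (fun p : M × M => kobayashiDist E p.1 p.2) (diagonal M)ᶜ

variable {E} in
/-- The canonical identification of the holomorphic tangent space with the tangent space of the
underlying real manifold. In Mathlib both are copies of the model space `E`, the copy at `z` being
attached to the same preferred chart at `z`. -/
def toRealTangent {z : M} (v : TangentSpace 𝓘(ℂ, E) z) : TangentSpace 𝓘(ℝ, E) z := v

variable {E} in
/-- The inverse of `toRealTangent`. -/
def ofRealTangent {z : M} (v : TangentSpace 𝓘(ℝ, E) z) : TangentSpace 𝓘(ℂ, E) z := v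

variable {E} in
/-- The value `(dk_M)_{(z,w)}(v, v')` of the (real) differential of the Kobayashi distance, as a
function on `M × M`, at the tangent vector `(v, v')`. -/
def kobayashiDifferential (z w : M) (v : TangentSpace 𝓘(ℂ, E) z) (v' : TangentSpace 𝓘(ℂ, E) w) :
    ℝ :=
  mfderiv (𝓘(ℝ, E).prod 𝓘(ℝ, E)) 𝓘(ℝ, ℝ) (fun p : M × M => kobayashiDist E p.1 p.2) (z, w)
    (toRealTangent v, toRealTangent v')

variable (M) in
/-- A (smooth) Hermitian metric along the fibres of `TM`. Smoothness is stated as smoothness of the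
coefficients in the coordinate frame of each preferred chart. -/
structure HermitianMetric [IsManifold 𝓘(ℂ, E) ω M] where
  /-- The Hermitian product on each tangent space, conjugate linear in the first variable. -/
  inner (z : M) : TangentSpace 𝓘(ℂ, E) z →ₗ⋆[ℂ] TangentSpace 𝓘(ℂ, E) z →ₗ[ℂ] ℂ
  conj_symm (z : M) (v w : TangentSpace 𝓘(ℂ, E) z) :
    (starRingEnd ℂ) (inner z v w) = inner z w v
  pos (z : M) (v : TangentSpace 𝓘(ℂ, E) z) : v ≠ 0 → 0 < (inner z v v).re
  smooth (z₀ : M) (v w : E) : ContMDiffOn 𝓘(ℝ, E) 𝓘(ℝ, ℂ) ∞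
    (fun z => inner z
      ((trivializationAt E (TangentSpace 𝓘(ℂ, E) (M := M)) z₀).symm z v)
      ((trivializationAt E (TangentSpace 𝓘(ℂ, E) (M := M)) z₀).symm z w))
    (chartAt E z₀).source

namespace HermitianMetric

variable {E} [IsManifold 𝓘(ℂ, E) ω M]

/-- The length `‖v‖` of a tangent vector. -/
def norm (h : HermitianMetric E M) (z : M) (v : TangentSpace 𝓘(ℂ, E) z) : ℝ :=
  √((h.inner z v v).re)

/-- The distance induced on `M` by a Hermitian metric: the infimum of the lengths
`∫ ‖γ'(t)‖ dt` of the `C^1` paths joining `z` to `w`. -/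
def edist (h : HermitianMetric E M) (z w : M) : ℝ≥0∞ :=
  letI : ∀ x : M, ENorm (TangentSpace 𝓘(ℝ, E) x) :=
    fun x => ⟨fun v => ENNReal.ofReal (h.norm x (ofRealTangent v))⟩
  Manifold.riemannianEDist 𝓘(ℝ, E) z w

end HermitianMetric

variable {E} [IsManifold 𝓘(ℂ, E) ω M]

/-- `G(z, t)` is a weak holomorphic vector field of order `d` on `M`. Only times `t ≥ 0` matter.
Measurability in `t` is Lebesgue measurability on `[0, ∞)`. -/
structure IsWeakHolomorphicVectorField (h : HermitianMetric E M) (d : ℝ≥0∞)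
    (G : (z : M) → ℝ → TangentSpace 𝓘(ℂ, E) z) : Prop where
  measurable (z : M) : AEStronglyMeasurable (fun t => (G z t : E)) (volume.restrict (Ici 0))
  holomorphic (t : ℝ) : 0 ≤ t → MDifferentiable 𝓘(ℂ, E) 𝓘(ℂ, E).tangent
    (fun z => (⟨z, G z t⟩ : TangentBundle 𝓘(ℂ, E) M))
  bound (K : Set M) (T : ℝ) : IsCompact K → 0 < T →
    ∃ C : ℝ → ℝ, (∀ t ∈ Icc 0 T, 0 ≤ C t) ∧ MemLp C d (volume.restrict (Icc 0 T)) ∧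
      ∀ᵐ t ∂volume.restrict (Icc 0 T), ∀ z ∈ K, h.norm z (G z t) ≤ C t

/-- `G(z, t)` is a Herglotz vector field of order `d` on `M` (where `k_M` is supposed to be `C^1`
off the diagonal): a weak holomorphic vector field of order `d` such that
`(dk_M)_{(z,w)}(G(z,t), G(w,t)) ≤ 0` for almost every `t` and all `z ≠ w`. -/
structure IsHerglotzVectorField (h : HermitianMetric E M) (d : ℝ≥0∞)
    (G : (z : M) → ℝ → TangentSpace 𝓘(ℂ, E) z) : Prop
    extends IsWeakHolomorphicVectorField h d G where
  dk_nonpos : ∀ᵐ t ∂volume.restrict (Ici 0), ∀ z w : M, z ≠ w →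
    kobayashiDifferential z w (G z t) (G w t) ≤ 0

/-- `(φ s t)`, `0 ≤ s ≤ t`, is an evolution family of order `d` on `M`. The values of `φ s t` for
other `s`, `t` are irrelevant. -/
structure IsEvolutionFamily (h : HermitianMetric E M) (d : ℝ≥0∞) (φ : ℝ → ℝ → M → M) :
    Prop where
  refl (s : ℝ) : 0 ≤ s → φ s s = id
  comp (s u t : ℝ) : 0 ≤ s → s ≤ u → u ≤ t → φ s t = φ u t ∘ φ s u
  holomorphic (s t : ℝ) : 0 ≤ s → s ≤ t → MDifferentiable 𝓘(ℂ, E) 𝓘(ℂ, E) (φ s t)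
  bound (K : Set M) (T : ℝ) : IsCompact K → 0 < T →
    ∃ c : ℝ → ℝ, (∀ ξ ∈ Icc 0 T, 0 ≤ c ξ) ∧ MemLp c d (volume.restrict (Icc 0 T)) ∧
      ∀ s t' t : ℝ, 0 ≤ s → s ≤ t' → t' ≤ t → t ≤ T → ∀ z ∈ K,
        h.edist (φ s t z) (φ s t' z) ≤ ENNReal.ofReal (∫ ξ in t'..t, c ξ)

/-- The Loewner equation `∂φ_{s,t}(z)/∂t = G(φ_{s,t}(z), t)`, for all `s ≥ 0`, all `z ∈ M` and
almost every `t ∈ [s, ∞)`. -/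
def SolvesLoewner (φ : ℝ → ℝ → M → M) (G : (z : M) → ℝ → TangentSpace 𝓘(ℂ, E) z) : Prop :=
  ∀ s : ℝ, 0 ≤ s → ∀ z : M, ∀ᵐ t ∂volume.restrict (Ici s),
    HasMFDerivAt 𝓘(ℝ, ℝ) 𝓘(ℝ, E) (fun τ : ℝ => φ s τ z) t
      ((1 : ℝ →L[ℝ] ℝ).smulRight (toRealTangent (G (φ s t z) t)))

end Manifold

end Loewner

end

/-! Order `∞` makes orbits Lipschitz in time, locally uniformly in the starting point
(`IsEvolutionFamily.exists_norm_chart_sub_le`, `exists_lipschitzOnWith`), so each orbit is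
differentiable at almost every time. The exceptional null set depends on the orbit, so only
countably many orbits are used: those from rational times q and points z_n of a dense sequence. Off
one null set of times they are all differentiable.

At such a regular time t the quotients (φ_{t,τ}(y) - y)/(τ - t), read in a chart, are holomorphic in
y and bounded as τ ↓ t. If y = φ_{q,t}(z_n), then φ_{t,τ}(y) = φ_{q,τ}(z_n), so they converge; such
y are dense because φ_{q,t} tends to the identity as q ↑ t. Vitali's theorem
(`exists_differentiableOn_tendsto_of_vitali`) then gives a holomorphic limit at every y
(`exists_generator_chart`). This right derivative is G. An orbit that is differentiable at t has the
same derivative from the right, hence solves the Loewner equation there.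

G(z, ·) is measurable as an almost everywhere limit of derivatives of orbits of z started at grid
times approaching t from the left (`tendsto_deriv_orbit`). Since φ_{t,τ} contracts k_M, the right
derivative of k_M(φ_{t,τ}(z), φ_{t,τ}(w)) at τ = t is at most 0, which is the Herglotz inequality.
For uniqueness, at almost every t two solutions agree at the dense set of points φ_{q,t}(z_n), and
both are continuous in space. -/

noncomputable section

namespace Loewner

/-! ### Vitali's theorem for bounded families of holomorphic maps -/

section Vitali

variable {E F : Type*} [NormedAddCommGroup E] [NormedSpace ℂ E]
  [NormedAddCommGroup F] [NormedSpace ℂ F]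

/-- The **Schwarz lemma** for a holomorphic map on a ball which is bounded by `L`. -/
lemma dist_le_of_differentiableOn_ball_of_norm_le {f : E → F} {x : E} {r L : ℝ}
    (hf : DifferentiableOn ℂ f (Metric.ball x r)) (hL : ∀ y ∈ Metric.ball x r, ‖f y‖ ≤ L)
    {z : E} (hz : z ∈ Metric.ball x r) :
    dist (f z) (f x) ≤ 2 * L / r * dist z x := by
  refine Complex.dist_le_div_mul_dist_of_mapsTo_ball hf (fun y hy => ?_) hz
  rw [mem_closedBall_iff_norm]
  have hx : x ∈ Metric.ball x r := Metric.mem_ball_self (Metric.nonempty_ball.1 ⟨z, hz⟩)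
  linarith [norm_sub_le (f y) (f x), hL y hy, hL x hx]

variable {ι : Type*} {l : Filter ι} {f : ι → E → F} {x : E} {r L : ℝ}

/-- The Schwarz lemma makes the family equicontinuous near y, so the Cauchy property at one point of
S close to y spreads to a whole ball around y. -/
lemma eventually_dist_lt_nhds_of_vitali (hL : 0 ≤ L)
    (hf : ∀ᶠ i in l, DifferentiableOn ℂ (f i) (Metric.ball x r))
    (hb : ∀ᶠ i in l, ∀ y ∈ Metric.ball x r, ‖f i y‖ ≤ L)
    {S : Set E} (hS : Metric.ball x r ⊆ closure S)
    (hconv : ∀ y ∈ S ∩ Metric.ball x r, ∃ v, Tendsto (fun i => f i y) l (𝓝 v))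
    {ε : ℝ} (hε : 0 < ε) {y : E} (hy : y ∈ Metric.ball x r) :
    ∃ η > 0, ∀ᶠ p in l ×ˢ l, ∀ z ∈ Metric.ball y η, dist (f p.1 z) (f p.2 z) < ε := by
  obtain ⟨ρ, hρ, hρr⟩ : ∃ ρ > 0, Metric.ball y ρ ⊆ Metric.ball x r :=
    Metric.isOpen_iff.1 Metric.isOpen_ball y hy
  set C : ℝ := 2 * L / (ρ / 2) with hC
  have hC0 : 0 ≤ C := by positivity
  -- C is the Schwarz constant on a ball of radius ρ/2, and points of the η-ball lie within 2η of s.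
  -- Dividing by C + 1 covers the case L = 0.
  obtain ⟨η, hη, hη1, hη2⟩ : ∃ η > 0, η ≤ ρ / 4 ∧ C * (2 * η) ≤ ε / 4 := by
    refine ⟨min (ρ / 4) (ε / 4 / (2 * (C + 1))), by positivity, min_le_left _ _, ?_⟩
    calc C * (2 * min (ρ / 4) (ε / 4 / (2 * (C + 1))))
        ≤ (C + 1) * (2 * (ε / 4 / (2 * (C + 1)))) := by
          gcongr
          · linarith
          · exact min_le_right _ _
      _ = ε / 4 := by field_simp
  obtain ⟨s, hsS, hys⟩ := Metric.mem_closure_iff.1 (hS hy) η hη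
  have hsy : dist s y < η := by rwa [dist_comm]
  have hsub : Metric.ball s (ρ / 2) ⊆ Metric.ball x r := by
    refine Subset.trans (Metric.ball_subset_ball' ?_) hρr
    linarith
  obtain ⟨v, hv⟩ := hconv s ⟨hsS, hsub (Metric.mem_ball_self (by positivity))⟩
  have hlip : ∀ᶠ i in l, ∀ z ∈ Metric.ball y η, dist (f i z) (f i s) ≤ ε / 4 := by
    filter_upwards [hf, hb] with i hfi hbi z hz
    have hzs : dist z s ≤ 2 * η := by
      have := dist_triangle z y s
      rw [Metric.mem_ball] at hz
      linarith
    refine (dist_le_of_differentiableOn_ball_of_norm_le (hfi.mono hsub)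
      (fun w hw => hbi w (hsub hw)) ?_).trans ?_
    · rw [Metric.mem_ball]
      have := dist_triangle z y s
      rw [Metric.mem_ball] at hz
      linarith
    · exact (mul_le_mul_of_nonneg_left hzs hC0).trans hη2
  have hs : ∀ᶠ i in l, dist (f i s) v < ε / 4 := (Metric.tendsto_nhds.1 hv) _ (by positivity)
  refine ⟨η, hη, ?_⟩
  filter_upwards [(hlip.and hs).prod_mk (hlip.and hs)] with p hp z hz
  have h1 := hp.1.1 z hz
  have h2 := hp.2.1 z hz
  have := dist_triangle4 (f p.1 z) (f p.1 s) (f p.2 s) (f p.2 z)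
  have h3 := dist_triangle_right (f p.1 s) (f p.2 s) v
  rw [dist_comm (f p.2 s) (f p.2 z)] at this
  linarith [hp.1.2, hp.2.2]

/-- **Vitali's theorem**: a bounded family of holomorphic maps on a ball which converges on a dense
subset converges to a holomorphic map (on a smaller ball). -/
theorem exists_differentiableOn_tendsto_of_vitali [FiniteDimensional ℂ E] [CompleteSpace F]
    [l.NeBot] (hr : 0 < r) (hL : 0 ≤ L)
    (hf : ∀ᶠ i in l, DifferentiableOn ℂ (f i) (Metric.ball x r))
    (hb : ∀ᶠ i in l, ∀ y ∈ Metric.ball x r, ‖f i y‖ ≤ L)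
    {S : Set E} (hS : Metric.ball x r ⊆ closure S)
    (hconv : ∀ y ∈ S ∩ Metric.ball x r, ∃ v, Tendsto (fun i => f i y) l (𝓝 v)) :
    ∃ g : E → F, DifferentiableOn ℂ g (Metric.ball x (r / 4)) ∧
      ∀ y ∈ Metric.ball x (r / 4), Tendsto (fun i => f i y) l (𝓝 (g y)) := by
  have : ProperSpace E := FiniteDimensional.proper ℂ E
  have hunif : ∀ ε > 0, ∀ᶠ p in l ×ˢ l, ∀ z ∈ Metric.closedBall x (r / 2),
      dist (f p.1 z) (f p.2 z) < ε := by
    intro ε hε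
    refine (isCompact_closedBall x (r / 2)).induction_on
      (p := fun s => ∀ᶠ p in l ×ˢ l, ∀ z ∈ s, dist (f p.1 z) (f p.2 z) < ε) (by simp)
      (fun s t hst ht => by filter_upwards [ht] with p hp z hz using hp z (hst hz))
      (fun s t hs ht => by
        filter_upwards [hs, ht] with p hp hp' z hz using hz.elim (hp z) (hp' z))
      (fun y hy => ?_)
    obtain ⟨η, hη, h⟩ := eventually_dist_lt_nhds_of_vitali hL hf hb hS hconv hε
      (Metric.closedBall_subset_ball (by linarith) hy)
    exact ⟨_, mem_nhdsWithin_of_mem_nhds (Metric.ball_mem_nhds y hη), h⟩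
  have hsub : ∀ y ∈ Metric.ball x (r / 4), Metric.ball y (r / 4) ⊆ Metric.closedBall x (r / 2) := by
    intro y hy
    rw [Metric.mem_ball] at hy
    exact (Metric.ball_subset_ball' (by linarith)).trans Metric.ball_subset_closedBall
  have hsub' : Metric.closedBall x (r / 2) ⊆ Metric.ball x r :=
    Metric.closedBall_subset_ball (by linarith)
  have hr4 : 0 < r / 4 := by positivity
  have hlim : ∀ y ∈ Metric.ball x (r / 4), ∃ v, Tendsto (fun i => f i y) l (𝓝 v) := by
    intro y hy
    refine cauchy_map_iff_exists_tendsto.1 (cauchy_map_iff.2 ⟨inferInstance, ?_⟩)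
    refine Metric.uniformity_basis_dist.tendsto_right_iff.2 fun ε hε => ?_
    filter_upwards [hunif ε hε] with p hp
    exact hp y (hsub y hy (Metric.mem_ball_self hr4))
  -- Cauchy's estimate on balls of radius r/4: f i - f j moves by at most ε(r/4)/2 there, so its
  -- derivative is at most ε/2. Uniform convergence of the derivatives is what allows the limit to
  -- be differentiated.
  have hcauchy : UniformCauchySeqOn (fun i => fderiv ℂ (f i)) l (Metric.ball x (r / 4)) := by
    intro u hu
    obtain ⟨ε, hε, hεu⟩ := Metric.mem_uniformity_dist.1 hu
    filter_upwards [hunif (ε * (r / 4) / 4) (by positivity), hf.prod_mk hf] with p hp hfp y hy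
    refine hεu ?_
    have hmem : Metric.ball x r ∈ 𝓝 y :=
      Metric.isOpen_ball.mem_nhds (Metric.ball_subset_ball (by linarith) hy)
    rw [dist_eq_norm, ← fderiv_sub (hfp.1.differentiableAt hmem) (hfp.2.differentiableAt hmem)]
    have hd := (hfp.1.sub hfp.2).mono ((hsub y hy).trans hsub')
    refine (Complex.norm_fderiv_le_div_of_mapsTo_ball (R₂ := ε * (r / 4) / 2) hd
      (fun z hz => ?_) hr4).trans_lt ?_
    · rw [mem_closedBall_iff_norm]
      have h1 := hp z (hsub y hy hz)
      have h2 := hp y (hsub y hy (Metric.mem_ball_self hr4))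
      rw [dist_eq_norm] at h1 h2
      refine (norm_sub_le _ _).trans ?_
      simp only [Pi.sub_apply]
      linarith
    · rw [div_lt_iff₀ hr4]
      nlinarith [mul_pos hε hr4]
  have hlim' : ∀ y ∈ Metric.ball x (r / 4), ∃ v, Tendsto (fun i => fderiv ℂ (f i) y) l (𝓝 v) :=
    fun y hy => cauchy_map_iff_exists_tendsto.1 (hcauchy.cauchy_map hy)
  choose! g hg using hlim
  choose! g' hg' using hlim'
  have hunif' := hcauchy.tendstoUniformlyOn_of_tendsto hg'
  refine ⟨g, fun y hy => ?_, hg⟩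
  have hball : Metric.ball x (r / 4) ∈ 𝓝 y := Metric.isOpen_ball.mem_nhds hy
  refine (hasFDerivAt_of_tendstoUniformlyOnFilter (l := l) (f := f)
    (f' := fun i => fderiv ℂ (f i)) (g' := g') ?_ ?_
    (eventually_of_mem hball hg)).differentiableAt.differentiableWithinAt
  · exact (tendstoUniformlyOn_iff_tendstoUniformlyOnFilter.1 hunif').mono_right
      (le_principal_iff.2 hball)
  · filter_upwards [hf.prod_mk (eventually_of_mem hball fun z hz => hz)] with p hp
    exact (hp.1.differentiableAt (Metric.isOpen_ball.mem_nhds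
      (Metric.ball_subset_ball (by linarith) hp.2))).hasFDerivAt

end Vitali

/-! ### Curves and tangent vectors in charts -/

section Charts

variable {E : Type*} [NormedAddCommGroup E] [NormedSpace ℂ E]
  {M : Type*} [TopologicalSpace M] [ChartedSpace E M]

variable (E) in
/-- The derivative, at the point `y`, of the transition map from the preferred chart at `a` to the
preferred chart at `b`. -/
def transitionDeriv (a b y : M) : E →L[ℂ] E :=
  fderiv ℂ (chartAt E b ∘ (chartAt E a).symm) (chartAt E a y)

variable (E M) in
lemma isManifold_real [IsManifold 𝓘(ℂ, E) ω M] : IsManifold 𝓘(ℝ, E) 1 M := by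
  refine isManifold_of_contDiffOn _ _ _ fun e e' he he' => ?_
  have h := ModelWithCorners.contDiffOn_extendCoordChange (I := 𝓘(ℂ, E)) (n := ω)
    (IsManifold.subset_maximalAtlas he) (IsManifold.subset_maximalAtlas he')
  refine ((h.of_le (m := 1) le_top).restrict_scalars ℝ).mono ?_
  simp

omit [NormedSpace ℂ E] in
lemma eventually_mem_chart_ball (a : M) {R : ℝ} (hR : 0 < R) :
    ∀ᶠ y in 𝓝 a, y ∈ (chartAt E a).source ∧ chartAt E a y ∈ Metric.ball (chartAt E a a) R :=
  inter_mem ((chartAt E a).open_source.mem_nhds (mem_chart_source E a))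
    (((chartAt E a).continuousAt (mem_chart_source E a)).preimage_mem_nhds
      (Metric.ball_mem_nhds _ hR))

lemma transitionDeriv_self {a y : M} (ha : y ∈ (chartAt E a).source) :
    transitionDeriv E a a y = ContinuousLinearMap.id ℂ E := by
  refine HasFDerivAt.fderiv ((hasFDerivAt_id _).congr_of_eventuallyEq ?_)
  filter_upwards [(chartAt E a).open_target.mem_nhds ((chartAt E a).map_source ha)] with x hx
  simp [(chartAt E a).right_inv hx]

section Manifold

variable [IsManifold 𝓘(ℂ, E) ω M]

lemma hasFDerivAt_transition {a b y : M} (ha : y ∈ (chartAt E a).source)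
    (hb : y ∈ (chartAt E b).source) :
    HasFDerivAt (chartAt E b ∘ (chartAt E a).symm) (transitionDeriv E a b y) (chartAt E a y) := by
  have : IsManifold 𝓘(ℂ, E) 1 M := IsManifold.of_le (n := ω) le_top
  refine DifferentiableAt.hasFDerivAt (mdifferentiableAt_iff_differentiableAt.1 ?_)
  refine MDifferentiableAt.comp (I' := 𝓘(ℂ, E)) _ ?_
    (mdifferentiableAt_atlas_symm (chart_mem_atlas E a) ((chartAt E a).map_source ha))
  refine mdifferentiableAt_atlas (chart_mem_atlas E b) ?_
  rwa [(chartAt E a).left_inv ha]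

/-- This is the chain rule for the transition map. Continuity of f is a separate hypothesis, because
a chart takes arbitrary values outside its source and cannot detect that f stays in it. -/
lemma HasDerivWithinAt.chart_change {f : ℝ → M} {s : Set ℝ} {t : ℝ} {a b : M} {e : E}
    (hd : HasDerivWithinAt (fun τ => chartAt E a (f τ)) e s t) (hc : ContinuousWithinAt f s t)
    (ha : f t ∈ (chartAt E a).source) (hb : f t ∈ (chartAt E b).source) :
    HasDerivWithinAt (fun τ => chartAt E b (f τ)) (transitionDeriv E a b (f t) e) s t := by
  have h := ((hasFDerivAt_transition ha hb).restrictScalars ℝ).comp_hasDerivWithinAt t hd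
  refine h.congr_of_eventuallyEq ?_ ?_
  · filter_upwards [hc ((chartAt E a).open_source.mem_nhds ha)] with τ hτ
    simp [(chartAt E a).left_inv hτ]
  · simp [(chartAt E a).left_inv ha]

/-- A tangent vector at y is stored by its coordinates in the preferred chart at y, so trivializing
over the chart at a applies the derivative of the transition from y to a. -/
lemma trivializationAt_apply_eq_transitionDeriv (a y : M) (v : E) :
    haveI : IsManifold 𝓘(ℂ, E) 1 M := IsManifold.of_le (n := ω) le_top
    trivializationAt E (TangentSpace 𝓘(ℂ, E) (M := M)) a ⟨y, v⟩ = (y, transitionDeriv E y a y v) := by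
  have : IsManifold 𝓘(ℂ, E) 1 M := IsManifold.of_le (n := ω) le_top
  rw [TangentBundle.trivializationAt_apply]
  simp [transitionDeriv]

end Manifold

lemma hasFDerivWithinAt_smulRight_iff {f : ℝ → E} {s : Set ℝ} {t : ℝ} {v : E} :
    HasFDerivWithinAt f ((1 : ℝ →L[ℝ] ℝ).smulRight v) s t ↔ HasDerivWithinAt f v s t := by
  rw [hasDerivWithinAt_iff_hasFDerivWithinAt]
  have : (1 : ℝ →L[ℝ] ℝ).smulRight v = ContinuousLinearMap.toSpanSingleton ℝ v := by
    ext; simp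
  rw [this]

/-- The derivative of a curve in a manifold is its derivative in the preferred chart. -/
lemma hasMFDerivWithinAt_curve_iff {f : ℝ → M} {s : Set ℝ} {t : ℝ}
    {v : TangentSpace 𝓘(ℝ, E) (f t)} :
    HasMFDerivWithinAt 𝓘(ℝ, ℝ) 𝓘(ℝ, E) f s t ((1 : ℝ →L[ℝ] ℝ).smulRight v) ↔
      ContinuousWithinAt f s t ∧
        HasDerivWithinAt (fun τ => chartAt E (f t) (f τ)) (v : E) s t := by
  have hs : (extChartAt 𝓘(ℝ, ℝ) t).symm ⁻¹' s ∩ range 𝓘(ℝ, ℝ) = s := by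
    rw [extChartAt_model_space_eq_id]
    simp
  have key : HasFDerivWithinAt (fun τ => chartAt E (f t) (f τ)) ((1 : ℝ →L[ℝ] ℝ).smulRight (v : E))
      ((extChartAt 𝓘(ℝ, ℝ) t).symm ⁻¹' s ∩ range 𝓘(ℝ, ℝ)) t ↔
      HasDerivWithinAt (fun τ => chartAt E (f t) (f τ)) (v : E) s t := by
    rw [hs]
    exact hasFDerivWithinAt_smulRight_iff
  exact and_congr_right fun _ => key

lemma hasMFDerivAt_curve_iff {f : ℝ → M} {t : ℝ} {v : TangentSpace 𝓘(ℝ, E) (f t)} :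
    HasMFDerivAt 𝓘(ℝ, ℝ) 𝓘(ℝ, E) f t ((1 : ℝ →L[ℝ] ℝ).smulRight v) ↔
      ContinuousAt f t ∧ HasDerivAt (fun τ => chartAt E (f t) (f τ)) (v : E) t :=
  hasMFDerivWithinAt_univ.symm.trans <| hasMFDerivWithinAt_curve_iff.trans <|
    and_congr (continuousWithinAt_univ _ _) hasDerivWithinAt_univ

lemma hasMFDerivAt_curve_of_mdifferentiableAt {γ : ℝ → M} {t : ℝ}
    (hγ : MDifferentiableAt 𝓘(ℝ, ℝ) 𝓘(ℝ, E) γ t) :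
    HasMFDerivAt 𝓘(ℝ, ℝ) 𝓘(ℝ, E) γ t
      ((1 : ℝ →L[ℝ] ℝ).smulRight (mfderiv 𝓘(ℝ, ℝ) 𝓘(ℝ, E) γ t (1 : ℝ))) := by
  have h := hγ.hasMFDerivAt
  have h2 : mfderiv 𝓘(ℝ, ℝ) 𝓘(ℝ, E) γ t =
      (1 : ℝ →L[ℝ] ℝ).smulRight (mfderiv 𝓘(ℝ, ℝ) 𝓘(ℝ, E) γ t (1 : ℝ)) := by
    refine ContinuousLinearMap.ext_ring (R₁ := ℝ) ?_
    exact (one_smul ℝ _).symm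
  exact h2 ▸ h

end Charts

/-! ### Comparison of the Hermitian norm with the coordinate norm -/

section Metric

variable {E : Type*} [NormedAddCommGroup E] [NormedSpace ℂ E]
  {M : Type*} [TopologicalSpace M] [ChartedSpace E M] [IsManifold 𝓘(ℂ, E) ω M]

/-- The vector at `y` with coordinates `w` in the chart at `a`. -/
def tangentOfCoord (a y : M) : E →L[ℂ] TangentSpace 𝓘(ℂ, E) y :=
  (trivializationAt E (TangentSpace 𝓘(ℂ, E) (M := M)) a).symmL ℂ y

lemma tangentOfCoord_eq_symm {a y : M} (hy : y ∈ (chartAt E a).source) (w : E) :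
    tangentOfCoord a y w =
      (trivializationAt E (TangentSpace 𝓘(ℂ, E) (M := M)) a).symm y w :=
  Bundle.Trivialization.symmL_apply _ (by simpa using hy) w

lemma tangentOfCoord_eq_sum {ι : Type*} [Fintype ι] (b : Module.Basis ι ℂ E) (a y : M) (w : E) :
    tangentOfCoord a y w = ∑ i, b.repr w i • tangentOfCoord a y (b i) := by
  conv_lhs => rw [← b.sum_repr w]
  rw [map_sum]
  exact Finset.sum_congr rfl fun i _ => map_smul _ _ _

lemma tangentOfCoord_transitionDeriv {a y : M} (hy : y ∈ (chartAt E a).source)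
    (v : TangentSpace 𝓘(ℂ, E) y) : tangentOfCoord a y (transitionDeriv E y a y v) = v := by
  have h := (trivializationAt E (TangentSpace 𝓘(ℂ, E) (M := M)) a).symm_apply_apply_mk
    (b := y) (by simpa using hy) v
  have h2 := congrArg Prod.snd (trivializationAt_apply_eq_transitionDeriv (E := E) a y v)
  rw [tangentOfCoord_eq_symm hy]
  exact (congrArg _ h2.symm).trans h

lemma transitionDeriv_tangentOfCoord {a y : M} (hy : y ∈ (chartAt E a).source) (w : E) :
    transitionDeriv E y a y (tangentOfCoord a y w) = w := by
  have h := (trivializationAt E (TangentSpace 𝓘(ℂ, E) (M := M)) a).apply_mk_symm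
    (b := y) (by simpa using hy) w
  rw [tangentOfCoord_eq_symm hy]
  exact (congrArg Prod.snd (trivializationAt_apply_eq_transitionDeriv (E := E) a y _)).symm.trans
    (congrArg Prod.snd h)

namespace HermitianMetric

variable (h : HermitianMetric E M)

/-- The square of the length of a vector at `y` with coordinates `w` in the chart at `a`. -/
def coordNormSq (a y : M) (w : E) : ℝ :=
  (h.inner y (tangentOfCoord a y w) (tangentOfCoord a y w)).re

lemma norm_eq_sqrt_coordNormSq {a y : M} (hy : y ∈ (chartAt E a).source)
    (v : TangentSpace 𝓘(ℂ, E) y) : h.norm y v = √(h.coordNormSq a y (transitionDeriv E y a y v)) := by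
  rw [norm, coordNormSq, tangentOfCoord_transitionDeriv hy]

lemma coordNormSq_pos {a y : M} (hy : y ∈ (chartAt E a).source) {w : E} (hw : w ≠ 0) :
    0 < h.coordNormSq a y w := by
  refine h.pos y _ fun h0 => hw ?_
  have := transitionDeriv_tangentOfCoord hy w
  rw [h0] at this
  rw [← this]
  exact map_zero (transitionDeriv E y a y)

lemma coordNormSq_smul (a y : M) (r : ℝ) (w : E) :
    h.coordNormSq a y (r • w) = r ^ 2 * h.coordNormSq a y w := by
  have : r • w = (r : ℂ) • w := (Complex.coe_smul r w).symm
  rw [coordNormSq, coordNormSq, this, map_smul,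
    LinearMap.map_smulₛₗ (h.inner y),
    LinearMap.smul_apply, map_smul]
  simp
  ring

lemma coordNormSq_eq_sum {ι : Type*} [Fintype ι] (b : Module.Basis ι ℂ E) (a y : M) (w : E) :
    h.coordNormSq a y w = (∑ j, ∑ i, b.repr w j * ((starRingEnd ℂ) (b.repr w i) *
      h.inner y (tangentOfCoord a y (b i)) (tangentOfCoord a y (b j)))).re := by
  rw [coordNormSq, tangentOfCoord_eq_sum b a y w]
  congr 1
  rw [map_sum]
  refine Finset.sum_congr rfl fun j _ => ?_
  rw [map_smul, map_sum, LinearMap.sum_apply, smul_eq_mul, Finset.mul_sum]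
  refine Finset.sum_congr rfl fun i _ => ?_
  rw [LinearMap.map_smulₛₗ, LinearMap.smul_apply, smul_eq_mul]

/-- Smoothness of the metric is given for fixed frame vectors only; expansion in a basis of E yields
joint continuity in the point and the vector. -/
lemma continuousOn_coordNormSq [FiniteDimensional ℂ E] (a : M) :
    ContinuousOn (fun p : M × E => h.coordNormSq a p.1 p.2)
      ((chartAt E a).source ×ˢ univ) := by
  let b := Module.finBasis ℂ E
  simp only [h.coordNormSq_eq_sum b]
  refine Complex.continuous_re.comp_continuousOn ?_
  refine continuousOn_finsetSum _ fun j _ => continuousOn_finsetSum _ fun i _ => ?_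
  have hrepr : ∀ i, Continuous fun p : M × E => b.repr p.2 i := fun i =>
    (LinearMap.continuous_of_finiteDimensional (b.coord i)).comp continuous_snd
  refine (hrepr j).continuousOn.mul (((Complex.continuous_conj.comp (hrepr i)).continuousOn).mul ?_)
  refine ContinuousOn.congr ((h.smooth a (b i) (b j)).continuousOn.comp continuousOn_fst
    fun p hp => hp.1) fun p hp => ?_
  simp only [tangentOfCoord_eq_symm hp.1, Function.comp_apply]

/-- On a compact subset of a chart domain, the Hermitian norm is comparable with the norm of the
coordinates. -/
lemma exists_norm_bounds [FiniteDimensional ℂ E] {a : M} {K : Set M} (hK : IsCompact K)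
    (hKa : K ⊆ (chartAt E a).source) :
    ∃ c > 0, ∃ C > 0, ∀ y ∈ K, ∀ v : TangentSpace 𝓘(ℂ, E) y,
      c * ‖transitionDeriv E y a y v‖ ≤ h.norm y v ∧ h.norm y v ≤ C * ‖transitionDeriv E y a y v‖ := by
  have : ProperSpace E := FiniteDimensional.proper ℂ E
  have hcomp : IsCompact (K ×ˢ Metric.sphere (0 : E) 1) := hK.prod (isCompact_sphere 0 1)
  have hcont : ContinuousOn (fun p : M × E => h.coordNormSq a p.1 p.2)
      (K ×ˢ Metric.sphere (0 : E) 1) :=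
    (h.continuousOn_coordNormSq a).mono (prod_mono hKa (subset_univ _))
  -- A positive continuous function on the compact set K × sphere has a positive lower bound;
  -- homogeneity extends the bounds to all vectors.
  obtain ⟨m, hm, hmin⟩ : ∃ m > 0, ∀ p ∈ K ×ˢ Metric.sphere (0 : E) 1,
      m ≤ h.coordNormSq a p.1 p.2 := by
    refine hcomp.exists_forall_le' hcont fun p hp => h.coordNormSq_pos (hKa hp.1) ?_
    exact ne_zero_of_norm_ne_zero (by simp [mem_sphere_zero_iff_norm.1 hp.2])
  obtain ⟨B, hB⟩ := (hcomp.image_of_continuousOn hcont).bddAbove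
  have hB' : ∀ p ∈ K ×ˢ Metric.sphere (0 : E) 1, h.coordNormSq a p.1 p.2 ≤ max B 1 :=
    fun p hp => (hB (mem_image_of_mem _ hp)).trans (le_max_left _ _)
  refine ⟨√m, Real.sqrt_pos.2 hm, √(max B 1), Real.sqrt_pos.2 (by positivity), fun y hy v => ?_⟩
  rw [h.norm_eq_sqrt_coordNormSq (hKa hy)]
  generalize transitionDeriv E y a y v = w
  rcases eq_or_ne w 0 with rfl | hw
  · have : h.coordNormSq a y 0 = 0 := by
      simpa using h.coordNormSq_smul a y 0 0
    simp [this]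
  · have hw' : (y, ‖w‖⁻¹ • w) ∈ K ×ˢ Metric.sphere (0 : E) 1 := by
      refine ⟨hy, ?_⟩
      simp [norm_smul, norm_ne_zero_iff.2 hw]
    have hN : h.coordNormSq a y w = ‖w‖ ^ 2 * h.coordNormSq a y (‖w‖⁻¹ • w) := by
      rw [← coordNormSq_smul, smul_smul, mul_inv_cancel₀ (norm_ne_zero_iff.2 hw), one_smul]
    rw [hN, Real.sqrt_mul (by positivity), Real.sqrt_sq (norm_nonneg w)]
    constructor
    · rw [mul_comm]
      gcongr
      exact hmin _ hw'
    · rw [mul_comm]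
      gcongr
      exact hB' _ hw'

lemma norm_smul (y : M) (r : ℝ) (v : TangentSpace 𝓘(ℝ, E) y) :
    h.norm y (ofRealTangent (r • v)) = |r| * h.norm y (ofRealTangent v) := by
  have hy := mem_chart_source E y
  have hv : ∀ v : TangentSpace 𝓘(ℝ, E) y,
      h.norm y (ofRealTangent v) = √(h.coordNormSq y y (v : E)) := by
    intro v
    rw [h.norm_eq_sqrt_coordNormSq hy, transitionDeriv_self hy]
    rfl
  rw [hv, hv]
  have h2 : h.coordNormSq y y ((r • v : TangentSpace 𝓘(ℝ, E) y) : E) =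
    r ^ 2 * h.coordNormSq y y (v : E) := h.coordNormSq_smul y y r (v : E)
  rw [h2, Real.sqrt_mul (by positivity), Real.sqrt_sq_eq_abs]

end HermitianMetric

end Metric

/-! ### The Hermitian distance dominates chart distance -/

section Distance

variable {E : Type*} [NormedAddCommGroup E] [NormedSpace ℂ E]
  {M : Type*} [TopologicalSpace M] [ChartedSpace E M] [IsManifold 𝓘(ℂ, E) ω M]

namespace HermitianMetric

variable (h : HermitianMetric E M)

/-- The extended norms on the tangent spaces of the underlying real manifold. -/
@[reducible] def tangentENorm (x : M) : ENorm (TangentSpace 𝓘(ℝ, E) x) :=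
  ⟨fun v => ENNReal.ofReal (h.norm x (ofRealTangent v))⟩

/-- Homogeneity under real scalars is what reparametrization and reversal of paths require. -/
lemma enormSMulClass_tangent (x : M) :
    letI := h.tangentENorm x
    ENormSMulClass ℝ (TangentSpace 𝓘(ℝ, E) x) := by
  let := h.tangentENorm x
  refine ⟨fun r v => ?_⟩
  change ENNReal.ofReal _ = ‖r‖ₑ * ENNReal.ofReal _
  rw [h.norm_smul, ENNReal.ofReal_mul (abs_nonneg r), Real.enorm_eq_ofReal_abs]

/-- The length, with respect to a Hermitian metric, of a path. -/
def pathLength (γ : ℝ → M) (a b : ℝ) : ℝ≥0∞ :=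
  letI := h.tangentENorm
  Manifold.pathELength 𝓘(ℝ, E) γ a b

lemma edist_comm (z w : M) : h.edist z w = h.edist w z := by
  let := h.tangentENorm
  have := h.enormSMulClass_tangent
  exact Manifold.riemannianEDist_comm

lemma exists_path_of_edist_lt {z w : M} {r : ℝ≥0∞} (hr : h.edist z w < r) :
    ∃ γ : ℝ → M, γ 0 = z ∧ γ 1 = w ∧ ContMDiff 𝓘(ℝ, ℝ) 𝓘(ℝ, E) 1 γ ∧ h.pathLength γ 0 1 < r := by
  let := h.tangentENorm
  have := h.enormSMulClass_tangent
  obtain ⟨γ, h0, h1, hγ, hl, -⟩ :=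
    Manifold.exists_lt_locally_constant_of_riemannianEDist_lt hr zero_lt_one
  exact ⟨γ, h0, h1, hγ, hl⟩

lemma pathLength_mono (γ : ℝ → M) {a b b' : ℝ} (hb : b ≤ b') :
    h.pathLength γ a b ≤ h.pathLength γ a b' := by
  let := h.tangentENorm
  exact Manifold.pathELength_mono le_rfl hb

lemma pathLength_eq_lintegral (γ : ℝ → M) (a b : ℝ) :
    h.pathLength γ a b = ∫⁻ t in Icc a b,
      ENNReal.ofReal (h.norm (γ t) (ofRealTangent (mfderiv 𝓘(ℝ, ℝ) 𝓘(ℝ, E) γ t (1 : ℝ)))) := by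
  let := h.tangentENorm
  exact Manifold.pathELength_eq_lintegral_mfderiv_Icc

/-- The length of a path dominates the length of its image in a chart. -/
lemma enorm_sub_le_pathLength {a : M} {K : Set M} (hKa : K ⊆ (chartAt E a).source) {C : ℝ}
    (hC : 0 ≤ C)
    (hK : ∀ y ∈ K, ∀ v : TangentSpace 𝓘(ℂ, E) y, ‖transitionDeriv E y a y v‖ ≤ C * h.norm y v)
    {γ : ℝ → M} (hγ : ContMDiff 𝓘(ℝ, ℝ) 𝓘(ℝ, E) 1 γ) {t : ℝ} (ht : 0 ≤ t)
    (hγK : ∀ τ ∈ Icc 0 t, γ τ ∈ K) :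
    ‖chartAt E a (γ t) - chartAt E a (γ 0)‖ₑ ≤ ENNReal.ofReal C * h.pathLength γ 0 t := by
  have := isManifold_real E M
  rcases ht.eq_or_lt with rfl | ht'
  · simp
  have hcd : ContDiffOn ℝ 1 (fun τ => chartAt E a (γ τ)) (Icc 0 t) := by
    rw [← contMDiffOn_iff_contDiffOn]
    exact (contMDiffOn_chart (I := 𝓘(ℝ, E))).comp hγ.contMDiffOn fun τ hτ => hKa (hγK τ hτ)
  refine (enorm_sub_le_lintegral_derivWithin_Icc_of_contDiffOn_Icc hcd ht).trans ?_
  rw [pathLength_eq_lintegral, ← lintegral_const_mul' _ _ ENNReal.ofReal_ne_top]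
  refine setLIntegral_mono' measurableSet_Icc fun τ hτ => ?_
  have hd := hasMFDerivAt_curve_iff.1
    (hasMFDerivAt_curve_of_mdifferentiableAt (hγ.mdifferentiable one_ne_zero τ))
  have hd' := HasDerivWithinAt.chart_change (b := a) (s := Icc 0 t) hd.2.hasDerivWithinAt
    hd.1.continuousWithinAt (mem_chart_source E _) (hKa (hγK τ hτ))
  rw [hd'.derivWithin (uniqueDiffOn_Icc ht' τ hτ), ← ofReal_norm,
    ← ENNReal.ofReal_mul hC]
  exact ENNReal.ofReal_le_ofReal (hK _ (hγK τ hτ) _)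

/-- Near any point, the distance dominates the distance in the chart. -/
theorem exists_norm_chart_sub_le [FiniteDimensional ℂ E] [T2Space M] (a : M) :
    ∃ R > 0, ∃ C > 0, ∃ δ > 0, Metric.ball (chartAt E a a) R ⊆ (chartAt E a).target ∧
      ∀ z ∈ (chartAt E a).source, chartAt E a z ∈ Metric.ball (chartAt E a a) R →
        ∀ w, ∀ ρ : ℝ, 0 ≤ ρ → ρ < δ → h.edist z w ≤ ENNReal.ofReal ρ →
          w ∈ (chartAt E a).source ∧ ‖chartAt E a w - chartAt E a z‖ ≤ C * ρ := by
  have : ProperSpace E := FiniteDimensional.proper ℂ E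
  set ψ := chartAt E a with hψ
  obtain ⟨R', hR', hball⟩ := Metric.isOpen_iff.1 ψ.open_target _
    (ψ.map_source (mem_chart_source E a))
  obtain ⟨R, hR, hRR'⟩ : ∃ R > 0, 2 * R < R' := ⟨R' / 3, by positivity, by linarith⟩
  have hcl : Metric.closedBall (ψ a) (2 * R) ⊆ ψ.target :=
    (Metric.closedBall_subset_ball hRR').trans hball
  set K := ψ.symm '' Metric.closedBall (ψ a) (2 * R) with hKdef
  have hKc : IsCompact K :=
    (isCompact_closedBall _ _).image_of_continuousOn (ψ.continuousOn_symm.mono hcl)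
  have hKs : K ⊆ ψ.source := by
    rintro _ ⟨x, hx, rfl⟩
    exact ψ.map_target (hcl hx)
  set V := ψ.source ∩ ψ ⁻¹' Metric.ball (ψ a) (2 * R) with hV
  have hVo : IsOpen V := ψ.isOpen_inter_preimage Metric.isOpen_ball
  have hVK : V ⊆ K := fun y hy =>
    ⟨ψ y, Metric.ball_subset_closedBall hy.2, ψ.left_inv hy.1⟩
  obtain ⟨c, hc, _, _, hcK⟩ := h.exists_norm_bounds hKc hKs
  have hC : ∀ y ∈ K, ∀ v : TangentSpace 𝓘(ℂ, E) y,
      ‖transitionDeriv E y a y v‖ ≤ c⁻¹ * h.norm y v := by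
    intro y hy v
    rw [← div_eq_inv_mul, le_div_iff₀' hc]
    exact (hcK y hy v).1
  -- A path of length less than R c moves by less than R in the chart, so from the ball of radius R
  -- it cannot leave the ball of radius 2R, over which the norms are comparable.
  refine ⟨R, hR, c⁻¹, inv_pos.2 hc, R * c, by positivity,
    (Metric.ball_subset_closedBall.trans (Metric.closedBall_subset_closedBall (by linarith))).trans
      hcl, fun z hz hzR w ρ hρ hρδ hzw => ?_⟩
  -- The infimum of lengths need not be attained, so the estimate is proved for every ρ' slightly
  -- larger than ρ and then passed to the limit.
  have key : ∀ ρ', ρ < ρ' → ρ' < R * c → w ∈ ψ.source ∧ ‖ψ w - ψ z‖ ≤ c⁻¹ * ρ' := by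
    intro ρ' h1 h2
    have hρ' : 0 < ρ' := hρ.trans_lt h1
    obtain ⟨γ, rfl, rfl, hγ, hlen⟩ := h.exists_path_of_edist_lt
      (hzw.trans_lt ((ENNReal.ofReal_lt_ofReal_iff hρ').2 h1))
    have hest : ∀ t ∈ Icc (0 : ℝ) 1, Icc 0 t ⊆ γ ⁻¹' K → ‖ψ (γ t) - ψ (γ 0)‖ ≤ c⁻¹ * ρ' := by
      intro t ht hγK
      have := h.enorm_sub_le_pathLength hKs (inv_pos.2 hc).le hC hγ ht.1 hγK
      have h3 := this.trans (mul_le_mul_right ((h.pathLength_mono γ ht.2).trans hlen.le) _)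
      rw [← ENNReal.ofReal_mul (inv_pos.2 hc).le, ← ofReal_norm,
        ENNReal.ofReal_le_ofReal_iff (by positivity)] at h3
      exact h3
    -- Continuous induction: as long as the path has stayed in K, the length estimate puts it in the
    -- open set V ⊆ K, so it stays in K a little longer.
    have hsub : Icc (0 : ℝ) 1 ⊆ γ ⁻¹' K := by
      refine ((hKc.isClosed.preimage hγ.continuous).inter
        isClosed_Icc).Icc_subset_of_forall_mem_nhdsGT_of_Icc_subset
        (hVK ⟨hz, Metric.ball_subset_ball (by linarith) hzR⟩) fun t ht hsub => ?_
      have h4 := hest t ⟨ht.1, ht.2.le⟩ hsub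
      have hsrc : γ t ∈ ψ.source := hKs (hsub ⟨ht.1, le_rfl⟩)
      refine hγ.continuous.continuousWithinAt (mem_of_superset (hVo.mem_nhds ⟨hsrc, ?_⟩) hVK)
      have h5 : c⁻¹ * ρ' < R := by
        rw [← div_eq_inv_mul, div_lt_iff₀ hc]
        exact h2
      rw [mem_preimage, Metric.mem_ball]
      rw [Metric.mem_ball] at hzR
      have := dist_triangle (ψ (γ t)) (ψ (γ 0)) (ψ a)
      rw [dist_eq_norm (ψ (γ t)) (ψ (γ 0))] at this
      linarith
    exact ⟨hKs (hsub ⟨zero_le_one, le_rfl⟩), hest 1 ⟨zero_le_one, le_rfl⟩ hsub⟩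
  obtain ⟨ρ₀, hρ₀, hρ₀'⟩ := exists_between hρδ
  refine ⟨(key ρ₀ hρ₀ hρ₀').1, ?_⟩
  rw [← div_eq_inv_mul, le_div_iff₀ hc]
  refine le_of_forall_gt_imp_ge_of_dense fun ρ' hρ' => ?_
  rcases lt_or_ge ρ' (R * c) with h6 | h6
  · have := (key ρ' hρ' h6).2
    rwa [← div_eq_inv_mul, le_div_iff₀ hc] at this
  · have := (key ρ₀ hρ₀ hρ₀').2
    rw [← div_eq_inv_mul, le_div_iff₀ hc] at this
    linarith

end HermitianMetric

end Distance

/-! ### Regularity in time of the orbits -/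

section Evolution

variable {E : Type*} [NormedAddCommGroup E] [NormedSpace ℂ E]
  {M : Type*} [TopologicalSpace M] [ChartedSpace E M] [IsManifold 𝓘(ℂ, E) ω M]

lemma hasMFDerivAt_of_hasDerivAt_chart {f : ℝ → M} {t : ℝ} {a : M} {e : E}
    (hc : ContinuousAt f t) (ha : f t ∈ (chartAt E a).source)
    (hd : HasDerivAt (fun τ => chartAt E a (f τ)) e t) :
    HasMFDerivAt 𝓘(ℝ, ℝ) 𝓘(ℝ, E) f t ((1 : ℝ →L[ℝ] ℝ).smulRight
      (show TangentSpace 𝓘(ℝ, E) (f t) from transitionDeriv E a (f t) (f t) e)) :=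
  hasMFDerivAt_curve_iff.2 ⟨hc, hasDerivWithinAt_univ.1 <|
    HasDerivWithinAt.chart_change (hasDerivWithinAt_univ.2 hd) hc.continuousWithinAt ha
      (mem_chart_source E _)⟩

namespace IsEvolutionFamily

variable {h : HermitianMetric E M} {φ : ℝ → ℝ → M → M}

/-- An evolution family of order `∞` is Lipschitz in time, locally uniformly. -/
lemma exists_edist_le (hφ : IsEvolutionFamily h ∞ φ) {K : Set M} (hK : IsCompact K) {T : ℝ}
    (hT : 0 < T) : ∃ C > 0, ∀ s t' t : ℝ, 0 ≤ s → s ≤ t' → t' ≤ t → t ≤ T → ∀ z ∈ K,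
      h.edist (φ s t z) (φ s t' z) ≤ ENNReal.ofReal (C * (t - t')) := by
  obtain ⟨c, -, hc, hcb⟩ := hφ.bound K T hK hT
  set B := (eLpNormEssSup c (volume.restrict (Icc 0 T))).toReal with hB
  have hfin : eLpNormEssSup c (volume.restrict (Icc 0 T)) < ⊤ := by
    simpa [eLpNorm_exponent_top] using hc.2
  have hcB : ∀ᵐ ξ, ξ ∈ Icc 0 T → ‖c ξ‖ ≤ B + 1 := by
    refine (ae_restrict_iff' measurableSet_Icc).1 ?_
    filter_upwards [ae_le_eLpNormEssSup (f := c) (μ := volume.restrict (Icc 0 T))] with ξ hξ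
    have := ENNReal.toReal_mono hfin.ne hξ
    rw [toReal_enorm] at this
    linarith
  -- The summand 1 keeps the Lipschitz constant positive when the essential supremum vanishes.
  refine ⟨B + 1, by positivity, fun s t' t hs hst' ht't htT z hz => ?_⟩
  refine (hcb s t' t hs hst' ht't htT z hz).trans (ENNReal.ofReal_le_ofReal ?_)
  have := intervalIntegral.norm_integral_le_of_norm_le_const_ae (a := t') (b := t) (f := c)
    (C := B + 1) (by
      filter_upwards [hcB] with ξ hξ hmem
      rw [uIoc_of_le ht't] at hmem
      exact hξ ⟨by linarith [hmem.1], hmem.2.trans htT⟩)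
  rw [abs_of_nonneg (by linarith)] at this
  exact (le_abs_self _).trans this

variable [FiniteDimensional ℂ E] [T2Space M]

/-- Locally uniformly in space, `φ s t` is close to the identity for `s` close to `t`. -/
lemma exists_norm_chart_sub_le (hφ : IsEvolutionFamily h ∞ φ) (a : M) {T : ℝ} (hT : 0 < T) :
    ∃ R > 0, ∃ L > 0, ∃ δ > 0, Metric.ball (chartAt E a a) R ⊆ (chartAt E a).target ∧
      ∀ y ∈ (chartAt E a).source, chartAt E a y ∈ Metric.ball (chartAt E a a) R →
        ∀ s t : ℝ, 0 ≤ s → s ≤ t → t ≤ T → t - s < δ →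
          φ s t y ∈ (chartAt E a).source ∧
            ‖chartAt E a (φ s t y) - chartAt E a y‖ ≤ L * (t - s) := by
  have : ProperSpace E := FiniteDimensional.proper ℂ E
  obtain ⟨R, hR, C, hC, δ, hδ, hRt, hest⟩ := h.exists_norm_chart_sub_le a
  have hcl : Metric.closedBall (chartAt E a a) (R / 2) ⊆ (chartAt E a).target :=
    (Metric.closedBall_subset_ball (by linarith)).trans hRt
  obtain ⟨B, hB, hφB⟩ := hφ.exists_edist_le
    ((isCompact_closedBall _ _).image_of_continuousOn ((chartAt E a).continuousOn_symm.mono hcl)) hT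
  refine ⟨R / 2, by positivity, C * B, by positivity, δ / B, by positivity,
    (Metric.ball_subset_ball (by linarith)).trans hRt, fun y hy hyR s t hs hst htT hts => ?_⟩
  have h1 := hφB s s t hs le_rfl hst htT y
    ⟨_, Metric.ball_subset_closedBall hyR, (chartAt E a).left_inv hy⟩
  -- The bound was taken at t' = s, where φ s s is the identity, so it compares φ s t y with y
  -- itself.
  rw [hφ.refl s hs, id, h.edist_comm] at h1
  rw [mul_assoc]
  refine hest y hy (Metric.ball_subset_ball (by linarith) hyR) _ _
    (mul_nonneg hB.le (by linarith)) ?_ h1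
  rwa [lt_div_iff₀' hB] at hts

/-- The orbits of an evolution family of order `∞` are locally Lipschitz. -/
lemma exists_lipschitzOnWith (hφ : IsEvolutionFamily h ∞ φ) {s : ℝ} (hs : 0 ≤ s) (z : M) {t₀ : ℝ}
    (ht₀ : s < t₀) : ∃ ε > 0, ∃ L, s ≤ t₀ - ε ∧
      (∀ t ∈ Ioo (t₀ - ε) (t₀ + ε), φ s t z ∈ (chartAt E (φ s t₀ z)).source) ∧
      LipschitzOnWith L (fun t => chartAt E (φ s t₀ z) (φ s t z)) (Ioo (t₀ - ε) (t₀ + ε)) := by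
  set a := φ s t₀ z with ha
  obtain ⟨R, hR, C, hC, δ, hδ, hRt, hest⟩ := h.exists_norm_chart_sub_le a
  obtain ⟨B, hB, hφB⟩ := hφ.exists_edist_le (isCompact_singleton (x := z))
    (show 0 < t₀ + 1 by linarith)
  have hφB' : ∀ t ∈ Icc s (t₀ + 1), ∀ t' ∈ Icc s (t₀ + 1),
      h.edist (φ s t z) (φ s t' z) ≤ ENNReal.ofReal (B * |t' - t|) := by
    intro t ht t' ht'
    rcases le_total t' t with h1 | h1
    · rw [abs_sub_comm, abs_of_nonneg (by linarith)]
      exact hφB s t' t hs ht'.1 h1 ht.2 z rfl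
    · rw [h.edist_comm, abs_of_nonneg (by linarith)]
      exact hφB s t t' hs ht.1 h1 ht'.2 z rfl
  -- The third condition lets the chart estimate apply to any two times of the interval; the fourth
  -- keeps the orbit in the ball of radius R about a.
  obtain ⟨ε, hε, h1, h2, h3, h4⟩ : ∃ ε > 0, ε ≤ t₀ - s ∧ ε ≤ 1 ∧ B * (2 * ε) < δ ∧
      C * (B * ε) < R := by
    refine ⟨min (min (t₀ - s) 1) (min (δ / B / 3) (R / (C * B) / 2)), ?_, ?_, ?_, ?_, ?_⟩
    · have : 0 < t₀ - s := by linarith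
      positivity
    · exact (min_le_left _ _).trans (min_le_left _ _)
    · exact (min_le_left _ _).trans (min_le_right _ _)
    · calc _ ≤ B * (2 * (δ / B / 3)) := by
            gcongr
            exact (min_le_right _ _).trans (min_le_left _ _)
        _ = 2 / 3 * δ := by field_simp
        _ < δ := by linarith
    · calc _ ≤ C * (B * (R / (C * B) / 2)) := by
            gcongr
            exact (min_le_right _ _).trans (min_le_right _ _)
        _ = R / 2 := by field_simp
        _ < R := by linarith
  have hI : Ioo (t₀ - ε) (t₀ + ε) ⊆ Icc s (t₀ + 1) := fun t ht =>
    ⟨by linarith [ht.1], by linarith [ht.2]⟩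
  have hnear : ∀ t ∈ Ioo (t₀ - ε) (t₀ + ε), φ s t z ∈ (chartAt E a).source ∧
      chartAt E a (φ s t z) ∈ Metric.ball (chartAt E a a) R := by
    intro t ht
    have habs : |t - t₀| < ε := abs_lt.2 ⟨by linarith [ht.1], by linarith [ht.2]⟩
    have h5 := hest a (mem_chart_source E a) (Metric.mem_ball_self hR) (φ s t z) (B * |t - t₀|)
      (by positivity) ?_ (hφB' t₀ ⟨ht₀.le, by linarith⟩ t (hI ht))
    · refine ⟨h5.1, ?_⟩
      rw [mem_ball_iff_norm]
      refine h5.2.trans_lt (lt_of_le_of_lt ?_ h4)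
      gcongr
    · refine lt_of_le_of_lt ?_ h3
      gcongr
      linarith
  refine ⟨ε, hε, (C * B).toNNReal, by linarith, fun t ht => (hnear t ht).1, ?_⟩
  refine LipschitzOnWith.of_dist_le_mul fun t ht t' ht' => ?_
  rw [Real.coe_toNNReal _ (by positivity), dist_comm, dist_eq_norm, dist_comm, Real.dist_eq,
    mul_assoc]
  refine (hest (φ s t z) (hnear t ht).1 (hnear t ht).2 _ _ (by positivity) ?_
    (hφB' t (hI ht) t' (hI ht'))).2
  refine lt_of_le_of_lt ?_ h3
  gcongr
  exact abs_le.2 ⟨by linarith [ht.2, ht'.1], by linarith [ht.1, ht'.2]⟩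

/-- The orbits of an evolution family of order `∞` are almost everywhere differentiable. -/
lemma ae_mdifferentiableAt (hφ : IsEvolutionFamily h ∞ φ) {s : ℝ} (hs : 0 ≤ s) (z : M) :
    ∀ᵐ t ∂volume.restrict (Ici s), s < t ∧
      MDifferentiableAt 𝓘(ℝ, ℝ) 𝓘(ℝ, E) (fun τ => φ s τ z) t := by
  rw [← restrict_Ioi_eq_restrict_Ici]
  have hfd : FiniteDimensional ℝ E := FiniteDimensional.complexToReal E
  refine (ae_restrict_iff' measurableSet_Ioi).2 ?_
  rw [ae_iff]
  -- The Lipschitz bound and the chart are only local in time; near each t₀, one-dimensional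
  -- Rademacher applies in the chart at φ s t₀ z.
  refine measure_null_of_locally_null _ fun t₀ ht₀ => ?_
  have ht₀' : s < t₀ := by_contra fun hlt => ht₀ fun hmem => absurd hmem hlt
  obtain ⟨ε, hε, L, hεs, hsrc, hL⟩ := hφ.exists_lipschitzOnWith hs z ht₀'
  refine ⟨_ ∩ Ioo (t₀ - ε) (t₀ + ε), inter_mem_nhdsWithin _ (Ioo_mem_nhds (by linarith)
    (by linarith)), ?_⟩
  refine measure_mono_null (t := {t | ¬(t ∈ Ioo (t₀ - ε) (t₀ + ε) → DifferentiableWithinAt ℝ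
    (fun t => chartAt E (φ s t₀ z) (φ s t z)) (Ioo (t₀ - ε) (t₀ + ε)) t)})
    (fun t ht hmem => ?_) (ae_iff.1 hL.ae_differentiableWithinAt_of_mem_real)
  refine ht.1 fun _ => ⟨by linarith [ht.2.1], ?_⟩
  have hI : Ioo (t₀ - ε) (t₀ + ε) ∈ 𝓝 t := isOpen_Ioo.mem_nhds ht.2
  have hd := (hmem ht.2).differentiableAt hI
  refine (hasMFDerivAt_of_hasDerivAt_chart ?_ (hsrc t ht.2) hd.hasDerivAt).mdifferentiableAt
  have hc := ((chartAt E (φ s t₀ z)).continuousAt_symm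
    ((chartAt E (φ s t₀ z)).map_source (hsrc t ht.2))).comp (f := fun τ =>
      chartAt E (φ s t₀ z) (φ s τ z)) hd.continuousAt
  refine hc.congr (eventually_of_mem hI fun τ hτ => ?_)
  exact (chartAt E (φ s t₀ z)).left_inv (hsrc τ hτ)

end IsEvolutionFamily

end Evolution

/-! ### The generator as a right derivative -/

section Generator

variable {E : Type*} [NormedAddCommGroup E] [NormedSpace ℂ E]
  {M : Type*} [TopologicalSpace M] [ChartedSpace E M] [SecondCountableTopology M] [Nonempty M]

variable (E) in
/-- A time `t > 0` at which all the orbits that start at a rational time, at a point of a fixed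
countable dense set, are differentiable. -/
def IsRegularTime (φ : ℝ → ℝ → M → M) (t : ℝ) : Prop :=
  0 < t ∧ ∀ q : ℚ, 0 ≤ (q : ℝ) → (q : ℝ) < t → ∀ n : ℕ,
    MDifferentiableAt 𝓘(ℝ, ℝ) 𝓘(ℝ, E) (fun τ => φ q τ (TopologicalSpace.denseSeq M n)) t

variable (E) in
open Classical in
/-- The right derivative at time `t` of `τ ↦ φ t τ z`, in the preferred chart at `z`, if `t` is a
regular time. -/
def rightVelocity (φ : ℝ → ℝ → M → M) (z : M) (t : ℝ) : E :=
  -- Holomorphy in z is demanded at every time; the value 0 secures it at the exceptional ones.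
  if IsRegularTime E φ t then derivWithin (fun τ => chartAt E z (φ t τ z)) (Ici t) t else 0

/-- The vector field that generates an evolution family. -/
def generator (φ : ℝ → ℝ → M → M) (z : M) (t : ℝ) : TangentSpace 𝓘(ℂ, E) z :=
  rightVelocity E φ z t

namespace IsEvolutionFamily

variable [IsManifold 𝓘(ℂ, E) ω M] {h : HermitianMetric E M} {φ : ℝ → ℝ → M → M}
  [FiniteDimensional ℂ E] [T2Space M]

lemma ae_isRegularTime (hφ : IsEvolutionFamily h ∞ φ) :
    ∀ᵐ t ∂volume.restrict (Ici 0), IsRegularTime E φ t := by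
  have h0 : ∀ᵐ t ∂volume.restrict (Ici (0 : ℝ)), 0 < t := by
    rw [← restrict_Ioi_eq_restrict_Ici]
    exact ae_restrict_mem measurableSet_Ioi
  refine h0.and (ae_all_iff.2 fun q => ?_)
  by_cases hq : 0 ≤ (q : ℝ)
  · have h1 : ∀ n, ∀ᵐ t ∂volume.restrict (Ici (q : ℝ)), MDifferentiableAt 𝓘(ℝ, ℝ) 𝓘(ℝ, E)
      (fun τ => φ q τ (TopologicalSpace.denseSeq M n)) t := fun n =>
      (hφ.ae_mdifferentiableAt hq _).mono fun t ht => ht.2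
    refine ae_restrict_of_ae ?_
    filter_upwards [(ae_restrict_iff' measurableSet_Ici).1 (ae_all_iff.2 h1)] with t ht _ hqt
    exact ht hqt.le
  · exact ae_of_all _ fun t ht => absurd ht hq

/-- The points `φ q t z`, for rational times `q < t` and `z` in a countable dense set, are dense. -/
lemma exists_flow_mem_nhds (hφ : IsEvolutionFamily h ∞ φ) {t : ℝ} (ht : 0 < t) {y : M} {U : Set M}
    (hU : U ∈ 𝓝 y) : ∃ q : ℚ, 0 ≤ (q : ℝ) ∧ (q : ℝ) < t ∧
      ∃ n, φ q t (TopologicalSpace.denseSeq M n) ∈ U := by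
  obtain ⟨R, hR, L, hL, δ, hδ, hRt, hest⟩ := hφ.exists_norm_chart_sub_le y ht
  set ψ := chartAt E y with hψ
  have hy : y ∈ ψ.source := mem_chart_source E y
  obtain ⟨ε, hε, hεU⟩ : ∃ ε > 0, Metric.ball (ψ y) ε ⊆ ψ.symm ⁻¹' U := by
    refine Metric.mem_nhds_iff.1 ((ψ.continuousAt_symm (ψ.map_source hy)).preimage_mem_nhds ?_)
    rwa [ψ.left_inv hy]
  have hopen : IsOpen (ψ.source ∩ ψ ⁻¹' Metric.ball (ψ y) (min R (ε / 2))) :=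
    ψ.isOpen_inter_preimage Metric.isOpen_ball
  obtain ⟨w, hw, n, rfl⟩ := (TopologicalSpace.denseRange_denseSeq M).inter_open_nonempty _ hopen
    ⟨y, hy, Metric.mem_ball_self (by positivity)⟩
  -- The point w is within ε/2 of y in the chart, and q is so close to t that the flow from q to t
  -- moves w by less than ε/2.
  obtain ⟨q, hq1, hq2⟩ := exists_rat_btwn (show max 0 (t - min δ (ε / 2 / L)) < t from
    max_lt ht (by have : 0 < min δ (ε / 2 / L) := by positivity
                  linarith))
  have hq0 : 0 ≤ (q : ℝ) := (le_max_left _ _).trans hq1.le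
  have hqt : t - q < min δ (ε / 2 / L) := by linarith [le_max_right 0 (t - min δ (ε / 2 / L))]
  obtain ⟨h1, h2⟩ := hest _ hw.1 (Metric.ball_subset_ball (min_le_left _ _) hw.2) q t hq0 hq2.le
    le_rfl (hqt.trans_le (min_le_left _ _))
  refine ⟨q, hq0, hq2, n, ?_⟩
  rw [← ψ.left_inv h1]
  refine hεU ?_
  have h3 : L * (t - q) < ε / 2 := by
    rw [← lt_div_iff₀' hL]
    exact hqt.trans_le (min_le_right _ _)
  have h4 := Metric.ball_subset_ball (min_le_right R (ε / 2)) hw.2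
  rw [Metric.mem_ball] at h4 ⊢
  refine (dist_triangle _ (ψ (TopologicalSpace.denseSeq M n)) _).trans_lt ?_
  rw [dist_eq_norm]
  linarith

omit [SecondCountableTopology M] [Nonempty M] in
lemma continuousWithinAt_flow (hφ : IsEvolutionFamily h ∞ φ) {t : ℝ} (ht : 0 ≤ t) (y : M) :
    ContinuousWithinAt (fun τ => φ t τ y) (Ici t) t := by
  obtain ⟨R, hR, L, hL, δ, hδ, hRt, hest⟩ :=
    hφ.exists_norm_chart_sub_le y (show 0 < t + 1 by linarith)
  set ψ := chartAt E y with hψ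
  have hy : y ∈ ψ.source := mem_chart_source E y
  have hev : ∀ᶠ τ in 𝓝[≥] t, φ t τ y ∈ ψ.source ∧ ‖ψ (φ t τ y) - ψ y‖ ≤ L * (τ - t) := by
    filter_upwards [self_mem_nhdsWithin, mem_nhdsWithin_of_mem_nhds
      (Iio_mem_nhds (show t < t + min δ 1 by linarith [lt_min hδ one_pos]))] with τ h1 h2
    rw [mem_Iio] at h2
    exact hest y hy (Metric.mem_ball_self hR) t τ ht h1
      (by linarith [min_le_right δ 1]) (by linarith [min_le_left δ 1])
  have h1 : Tendsto (fun τ => ψ (φ t τ y)) (𝓝[≥] t) (𝓝 (ψ y)) := by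
    rw [tendsto_iff_norm_sub_tendsto_zero]
    refine squeeze_zero' (Eventually.of_forall fun _ => norm_nonneg _) (hev.mono fun τ h => h.2) ?_
    have : Tendsto (fun τ => L * (τ - t)) (𝓝 t) (𝓝 (L * (t - t))) :=
      Continuous.tendsto (by fun_prop) t
    rw [sub_self, mul_zero] at this
    exact this.mono_left nhdsWithin_le_nhds
  have h2 := ((ψ.continuousAt_symm (ψ.map_source hy)).tendsto).comp h1
  rw [ψ.left_inv hy] at h2
  rw [ContinuousWithinAt, hφ.refl t ht, id]
  refine h2.congr' (hev.mono fun τ h => ψ.left_inv h.1)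

-- For τ ≥ t the composition law gives φ_{t,τ}(φ_{s,t}(z)) = φ_{s,τ}(z), so the flow started at time
-- t inherits the derivative of the orbit, but only from the right.
omit [SecondCountableTopology M] [Nonempty M] [FiniteDimensional ℂ E] [T2Space M] in
lemma hasDerivWithinAt_flow_of_mdifferentiableAt (hφ : IsEvolutionFamily h ∞ φ) {s t : ℝ}
    (hs : 0 ≤ s) (hst : s ≤ t) {z a : M}
    (hd : MDifferentiableAt 𝓘(ℝ, ℝ) 𝓘(ℝ, E) (fun τ => φ s τ z) t)
    (ha : φ s t z ∈ (chartAt E a).source) :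
    ∃ e, HasDerivAt (fun τ => chartAt E a (φ s τ z)) e t ∧
      HasDerivWithinAt (fun τ => chartAt E a (φ t τ (φ s t z))) e (Ici t) t := by
  have h1 := hasMFDerivAt_curve_iff.1 (hasMFDerivAt_curve_of_mdifferentiableAt hd)
  have h2 := hasDerivWithinAt_univ.1 <| HasDerivWithinAt.chart_change (b := a)
    (hasDerivWithinAt_univ.2 h1.2) h1.1.continuousWithinAt (mem_chart_source E _) ha
  refine ⟨_, h2, h2.hasDerivWithinAt.congr (fun τ hτ => ?_) ?_⟩
  · rw [hφ.comp s t τ hs hst hτ, Function.comp_apply]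
  · rw [hφ.refl t (hs.trans hst), id]

/-- At a regular time, the right derivative of the evolution family exists everywhere and is
holomorphic in the space variable; it is locally bounded uniformly in time. -/
theorem exists_generator_chart (hφ : IsEvolutionFamily h ∞ φ) (a : M) {T : ℝ} (hT : 0 < T) :
    ∃ R > 0, ∃ L > 0, Metric.ball (chartAt E a a) R ⊆ (chartAt E a).target ∧
      ∀ t ≤ T, IsRegularTime E φ t → ∃ g : E → E,
        DifferentiableOn ℂ g (Metric.ball (chartAt E a a) R) ∧
        (∀ x ∈ Metric.ball (chartAt E a a) R, ‖g x‖ ≤ L) ∧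
        ∀ y ∈ (chartAt E a).source, chartAt E a y ∈ Metric.ball (chartAt E a a) R →
          HasDerivWithinAt (fun τ => chartAt E a (φ t τ y)) (g (chartAt E a y)) (Ici t) t := by
  obtain ⟨R, hR, L, hL, δ, hδ, hRt, hest⟩ :=
    hφ.exists_norm_chart_sub_le a (show 0 < T + 1 by linarith)
  set ψ := chartAt E a with hψ
  have hRR : Metric.ball (ψ a) (R / 4) ⊆ Metric.ball (ψ a) R :=
    Metric.ball_subset_ball (by linarith)
  refine ⟨R / 4, by positivity, L, hL, hRR.trans hRt, fun t htT ht => ?_⟩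
  have ht0 : 0 ≤ t := ht.1.le
  set f : ℝ → E → E := fun τ x => slope (fun σ => ψ (φ t σ (ψ.symm x))) t τ with hf
  have hflow : ∀ᶠ τ in 𝓝[>] t, t < τ ∧ τ ≤ T + 1 ∧ ∀ x ∈ Metric.ball (ψ a) R,
      φ t τ (ψ.symm x) ∈ ψ.source ∧ ‖ψ (φ t τ (ψ.symm x)) - x‖ ≤ L * (τ - t) := by
    filter_upwards [self_mem_nhdsWithin, mem_nhdsWithin_of_mem_nhds
      (Iio_mem_nhds (show t < t + min δ 1 by linarith [lt_min hδ one_pos]))] with τ h1 h2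
    rw [mem_Iio] at h2
    rw [mem_Ioi] at h1
    have h3 : τ ≤ T + 1 := by linarith [min_le_right δ 1]
    refine ⟨h1, h3, fun x hx => ?_⟩
    have := hest (ψ.symm x) (ψ.map_target (hRt hx)) (by rwa [ψ.right_inv (hRt hx)]) t τ ht0 h1.le
      h3 (by linarith [min_le_left δ 1])
    rwa [ψ.right_inv (hRt hx)] at this
  have hstart : ∀ x ∈ Metric.ball (ψ a) R, ψ (φ t t (ψ.symm x)) = x := fun x hx => by
    rw [hφ.refl t ht0, id, ψ.right_inv (hRt hx)]
  have hdiff : ∀ᶠ τ in 𝓝[>] t, DifferentiableOn ℂ (f τ) (Metric.ball (ψ a) R) := by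
    filter_upwards [hflow] with τ hτ
    have h1 : DifferentiableOn ℂ (fun x => ψ (φ t τ (ψ.symm x))) (Metric.ball (ψ a) R) := by
      have : IsManifold 𝓘(ℂ, E) 1 M := IsManifold.of_le (n := ω) le_top
      intro x hx
      refine DifferentiableAt.differentiableWithinAt (mdifferentiableAt_iff_differentiableAt.1 ?_)
      have h2 := mdifferentiableAt_atlas_symm (I := 𝓘(ℂ, E)) (chart_mem_atlas E a) (hRt hx)
      have h3 := (hφ.holomorphic t τ ht0 hτ.1.le (ψ.symm x)).comp x h2
      exact (mdifferentiableAt_atlas (I := 𝓘(ℂ, E)) (chart_mem_atlas E a) (hτ.2.2 x hx).1).comp x h3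
    refine ((h1.sub differentiableOn_id).const_smul (τ - t)⁻¹).congr fun x hx => ?_
    simp only [hf, slope, hstart x hx, vsub_eq_sub, Pi.smul_apply, Pi.sub_apply, id]
  have hbound : ∀ᶠ τ in 𝓝[>] t, ∀ x ∈ Metric.ball (ψ a) R, ‖f τ x‖ ≤ L := by
    filter_upwards [hflow] with τ hτ x hx
    have h0 : 0 < τ - t := by linarith [hτ.1]
    simp only [hf, slope, hstart x hx, vsub_eq_sub, norm_smul, norm_inv, Real.norm_eq_abs,
      abs_of_pos h0]
    rw [inv_mul_le_iff₀ h0, mul_comm]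
    exact (hτ.2.2 x hx).2
  -- S holds the chart images of the countable set of orbit points at time t: convergence is known
  -- there by regularity of t, and `exists_flow_mem_nhds` makes it dense.
  set S : Set E := {x | ∃ q : ℚ, 0 ≤ (q : ℝ) ∧ (q : ℝ) < t ∧ ∃ n,
    φ q t (TopologicalSpace.denseSeq M n) ∈ ψ.source ∧
      ψ (φ q t (TopologicalSpace.denseSeq M n)) = x} with hS
  have hdense : Metric.ball (ψ a) R ⊆ closure S := by
    intro x hx
    rw [mem_closure_iff_nhds]
    intro V hV
    have hxs := ψ.map_target (hRt hx)
    have hU : ψ.source ∩ ψ ⁻¹' V ∈ 𝓝 (ψ.symm x) := by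
      refine inter_mem (ψ.open_source.mem_nhds hxs) ((ψ.continuousAt hxs).preimage_mem_nhds ?_)
      rwa [ψ.right_inv (hRt hx)]
    obtain ⟨q, hq0, hqt, n, hn⟩ := hφ.exists_flow_mem_nhds ht.1 hU
    exact ⟨_, hn.2, q, hq0, hqt, n, hn.1, rfl⟩
  have hconv : ∀ x ∈ S ∩ Metric.ball (ψ a) R, ∃ v, Tendsto (fun τ => f τ x) (𝓝[>] t) (𝓝 v) := by
    rintro _ ⟨⟨q, hq0, hqt, n, hn, rfl⟩, -⟩
    obtain ⟨e, -, he⟩ := hφ.hasDerivWithinAt_flow_of_mdifferentiableAt hq0 hqt.le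
      (ht.2 q hq0 hqt n) hn
    refine ⟨e, ?_⟩
    rw [← hasDerivWithinAt_Ioi_iff_Ici, hasDerivWithinAt_iff_tendsto_slope' self_notMem_Ioi] at he
    simp only [hf, ψ.left_inv hn]
    exact he
  obtain ⟨g, hg, hlim⟩ :=
    exists_differentiableOn_tendsto_of_vitali hR hL.le hdiff hbound hdense hconv
  refine ⟨g, hg, fun x hx => ?_, fun y hy hyR => ?_⟩
  · exact le_of_tendsto (hlim x hx).norm (hbound.mono fun τ hτ => hτ x (hRR hx))
  · rw [← hasDerivWithinAt_Ioi_iff_Ici, hasDerivWithinAt_iff_tendsto_slope' self_notMem_Ioi]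
    have := hlim _ hyR
    simp only [hf, ψ.left_inv hy] at this
    exact this

lemma hasDerivWithinAt_generator (hφ : IsEvolutionFamily h ∞ φ) {t : ℝ}
    (ht : IsRegularTime E φ t) {a y : M} (hy : y ∈ (chartAt E a).source) :
    HasDerivWithinAt (fun τ => chartAt E a (φ t τ y))
      (transitionDeriv E y a y (generator (E := E) φ y t)) (Ici t) t := by
  obtain ⟨R, hR, _, _, _, H⟩ := hφ.exists_generator_chart y ht.1
  obtain ⟨g, -, -, hg⟩ := H t le_rfl ht
  have h1 := hg y (mem_chart_source E y) (Metric.mem_ball_self hR)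
  have h2 : (generator (E := E) φ y t : E) = g (chartAt E y y) := by
    exact (if_pos ht).trans (h1.derivWithin (uniqueDiffWithinAt_Ici t))
  rw [h2]
  have h3 := HasDerivWithinAt.chart_change (b := a) h1 (hφ.continuousWithinAt_flow ht.1.le y)
    (by rw [hφ.refl t ht.1.le]; exact mem_chart_source E y) (by rwa [hφ.refl t ht.1.le])
  rwa [hφ.refl t ht.1.le] at h3

lemma hasMFDerivWithinAt_generator (hφ : IsEvolutionFamily h ∞ φ) {t : ℝ}
    (ht : IsRegularTime E φ t) (y : M) :
    HasMFDerivWithinAt 𝓘(ℝ, ℝ) 𝓘(ℝ, E) (fun τ => φ t τ y) (Ici t) t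
      ((1 : ℝ →L[ℝ] ℝ).smulRight
        (show TangentSpace 𝓘(ℝ, E) (φ t t y) from (generator (E := E) φ y t : E))) := by
  refine hasMFDerivWithinAt_curve_iff.2 ⟨hφ.continuousWithinAt_flow ht.1.le y, ?_⟩
  have h1 := hφ.hasDerivWithinAt_generator ht (mem_chart_source E y)
  rw [transitionDeriv_self (mem_chart_source E y)] at h1
  rw [hφ.refl t ht.1.le]
  exact h1

/-- At a regular time at which an orbit is differentiable, its derivative is the generator. -/
lemma hasMFDerivAt_orbit (hφ : IsEvolutionFamily h ∞ φ) {s t : ℝ} (hs : 0 ≤ s) (hst : s ≤ t)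
    (ht : IsRegularTime E φ t) {z : M}
    (hd : MDifferentiableAt 𝓘(ℝ, ℝ) 𝓘(ℝ, E) (fun τ => φ s τ z) t) :
    HasMFDerivAt 𝓘(ℝ, ℝ) 𝓘(ℝ, E) (fun τ => φ s τ z) t
      ((1 : ℝ →L[ℝ] ℝ).smulRight (toRealTangent (generator (E := E) φ (φ s t z) t))) := by
  refine hasMFDerivAt_curve_iff.2 ⟨hd.continuousAt, ?_⟩
  obtain ⟨e, h1, h2⟩ := hφ.hasDerivWithinAt_flow_of_mdifferentiableAt hs hst hd
    (mem_chart_source E (φ s t z))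
  have h3 := hφ.hasDerivWithinAt_generator ht (mem_chart_source E (φ s t z))
  rw [transitionDeriv_self (mem_chart_source E _)] at h3
  -- The two-sided derivative of the orbit and the generator are both right derivatives of the same
  -- curve.
  have h4 := (uniqueDiffWithinAt_Ici t).eq_deriv _ h2 h3
  rw [h4] at h1
  exact h1

/-- The generator of an evolution family solves the Loewner equation. -/
theorem solvesLoewner_generator (hφ : IsEvolutionFamily h ∞ φ) :
    SolvesLoewner φ (generator (E := E) φ) := by
  intro s hs z
  filter_upwards [hφ.ae_mdifferentiableAt hs z, ae_mono
    (Measure.restrict_mono (Ici_subset_Ici.2 hs) le_rfl) hφ.ae_isRegularTime] with t h1 h2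
  exact hφ.hasMFDerivAt_orbit hs h1.1.le h2 h1.2

end IsEvolutionFamily

end Generator

/-! ### Contraction of the Kobayashi distance -/

section Kobayashi

variable {E : Type*} [NormedAddCommGroup E] [NormedSpace ℂ E]
  {M : Type*} [TopologicalSpace M] [ChartedSpace E M]

variable (E) in
/-- The lengths of the chains of holomorphic discs from `z` to `w`. -/
def chainLengths (z w : M) : Set ℝ :=
  {r : ℝ | ∃ (m : ℕ) (p : ℕ → M) (f : ℕ → ℂ → M) (ζ η : ℕ → ℂ),
    p 0 = z ∧ p m = w ∧
    (∀ j < m, IsHolomorphicDisc E (f j) ∧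
      ζ j ∈ Metric.ball (0 : ℂ) 1 ∧ η j ∈ Metric.ball (0 : ℂ) 1 ∧
      f j (ζ j) = p j ∧ f j (η j) = p (j + 1)) ∧
    r = ∑ j ∈ Finset.range m, poincareDist (ζ j) (η j)}

lemma bddBelow_chainLengths (z w : M) : BddBelow (chainLengths E z w) := by
  refine ⟨0, ?_⟩
  rintro _ ⟨m, p, f, ζ, η, -, -, -, rfl⟩
  exact Finset.sum_nonneg fun j _ => Real.artanh_nonneg (norm_nonneg _)

lemma chainLengths_self_nonempty (z : M) : (chainLengths E z z).Nonempty :=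
  ⟨_, 0, fun _ => z, fun _ _ => z, fun _ => 0, fun _ => 0, rfl, rfl, by simp, rfl⟩

lemma chainLengths_nonempty_of_disc {z w w' : M} (h : (chainLengths E z w).Nonempty) {g : ℂ → M}
    (hg : IsHolomorphicDisc E g) {ζ₀ η₀ : ℂ} (hζ₀ : ζ₀ ∈ Metric.ball (0 : ℂ) 1)
    (hη₀ : η₀ ∈ Metric.ball (0 : ℂ) 1) (hw : g ζ₀ = w) (hw' : g η₀ = w') :
    (chainLengths E z w').Nonempty := by
  obtain ⟨_, m, p, f, ζ, η, h0, hm, hj, -⟩ := h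
  refine ⟨_, m + 1, Function.update p (m + 1) w', Function.update f m g, Function.update ζ m ζ₀,
    Function.update η m η₀, ?_, by simp, fun j hjm => ?_, rfl⟩
  · rwa [Function.update_of_ne (by omega)]
  · rcases (Nat.lt_succ_iff_lt_or_eq.1 hjm) with hlt | rfl
    · rw [Function.update_of_ne hlt.ne, Function.update_of_ne hlt.ne, Function.update_of_ne hlt.ne,
        Function.update_of_ne (by omega), Function.update_of_ne (by omega)]
      exact hj j hlt
    · rw [Function.update_self, Function.update_self, Function.update_self, Function.update_self,
        Function.update_of_ne (by omega), hm]
      exact ⟨hg, hζ₀, hη₀, hw, hw'⟩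

variable [IsManifold 𝓘(ℂ, E) ω M]

/-- Nearby points lie in a common holomorphic disc. -/
lemma eventually_exists_holomorphicDisc (w : M) :
    ∀ᶠ w' in 𝓝 w, ∃ g : ℂ → M, IsHolomorphicDisc E g ∧ g 0 = w ∧ g (1 / 2) = w' := by
  have : IsManifold 𝓘(ℂ, E) 1 M := IsManifold.of_le (n := ω) le_top
  set ψ := chartAt E w with hψ
  have hw : w ∈ ψ.source := mem_chart_source E w
  obtain ⟨r, hr, hball⟩ := Metric.isOpen_iff.1 ψ.open_target _ (ψ.map_source hw)
  filter_upwards [ψ.open_source.mem_nhds hw,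
    (ψ.continuousAt hw).preimage_mem_nhds (Metric.ball_mem_nhds _ (half_pos hr))] with w' h1 h2
  -- An affine disc in the chart; the factor 2 sends 1/2 to ψ w' and costs the halved radius.
  refine ⟨fun l => ψ.symm (ψ w + (2 * l) • (ψ w' - ψ w)), ?_, ?_, ?_⟩
  · have haff : MDifferentiableOn 𝓘(ℂ, ℂ) 𝓘(ℂ, E) (fun l : ℂ => ψ w + (2 * l) • (ψ w' - ψ w))
        (Metric.ball 0 1) := by
      refine DifferentiableOn.mdifferentiableOn (Differentiable.differentiableOn ?_)
      fun_prop
    refine (mdifferentiableOn_atlas_symm (I := 𝓘(ℂ, E)) (chart_mem_atlas E w)).comp haff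
      fun l hl => hball ?_
    rw [mem_ball_iff_norm, add_sub_cancel_left, norm_smul, norm_mul, Complex.norm_ofNat]
    rw [mem_ball_zero_iff] at hl
    rw [mem_preimage, mem_ball_iff_norm] at h2
    nlinarith [norm_nonneg l, norm_nonneg (ψ w' - ψ w)]
  · simp [ψ.left_inv hw]
  · simp [ψ.left_inv h1]

/-- In a connected complex manifold any two points are joined by a chain of holomorphic discs. -/
lemma chainLengths_nonempty [PreconnectedSpace M] (z w : M) : (chainLengths E z w).Nonempty := by
  have h0 : (0 : ℂ) ∈ Metric.ball (0 : ℂ) 1 := by simp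
  have h2 : (1 / 2 : ℂ) ∈ Metric.ball (0 : ℂ) 1 := by
    rw [mem_ball_zero_iff]
    norm_num
  -- A chain extends along a small disc in either direction: from w to w' for openness, from w' back
  -- to w for closedness.
  have hclopen : IsClopen {w | (chainLengths E z w).Nonempty} := by
    refine ⟨⟨isOpen_iff_mem_nhds.2 fun w hw => ?_⟩, isOpen_iff_mem_nhds.2 fun w hw => ?_⟩
    · filter_upwards [eventually_exists_holomorphicDisc (E := E) w] with w' ⟨g, hg, hg0, hg1⟩ hw'
      exact hw (chainLengths_nonempty_of_disc hw' hg h2 h0 hg1 hg0)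
    · filter_upwards [eventually_exists_holomorphicDisc (E := E) w] with w' ⟨g, hg, hg0, hg1⟩
      exact chainLengths_nonempty_of_disc hw hg h0 h2 hg0 hg1
  exact (hclopen.eq_univ ⟨z, chainLengths_self_nonempty z⟩).ge (mem_univ w)

/-- Holomorphic self-maps contract the Kobayashi distance. -/
theorem kobayashiDist_map_le [PreconnectedSpace M] {F : M → M}
    (hF : MDifferentiable 𝓘(ℂ, E) 𝓘(ℂ, E) F) (z w : M) :
    kobayashiDist E (F z) (F w) ≤ kobayashiDist E z w := by
  -- Composing a chain with F keeps its length. Nonemptiness is essential, since the real infimum of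
  -- the empty set is 0.
  refine csInf_le_csInf (bddBelow_chainLengths (E := E) (F z) (F w)) (chainLengths_nonempty z w) ?_
  rintro _ ⟨m, p, f, ζ, η, rfl, rfl, hj, rfl⟩
  refine ⟨m, fun j => F (p j), fun j => F ∘ f j, ζ, η, rfl, rfl, fun j hjm => ?_, rfl⟩
  obtain ⟨h1, h2, h3, h4, h5⟩ := hj j hjm
  exact ⟨hF.comp_mdifferentiableOn h1, h2, h3, congrArg F h4, congrArg F h5⟩

end Kobayashi

/-! ### Measurability, the Herglotz inequality and uniqueness -/

section Herglotz

/-- Approximation of t from the left by starting times that, for each k, take only countably many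
values and depend measurably on t. -/
lemma tendsto_floor_mul_div_add_one {t : ℝ} (ht : 0 ≤ t) :
    (∀ k : ℕ, (⌊((k : ℝ) + 1) * t⌋₊ : ℝ) / (k + 1) ≤ t) ∧
      Tendsto (fun k : ℕ => (⌊((k : ℝ) + 1) * t⌋₊ : ℝ) / (k + 1)) atTop (𝓝 t) := by
  have hk0 : ∀ k : ℕ, 0 < (k : ℝ) + 1 := fun k => by positivity
  have hqt : ∀ k : ℕ, (⌊((k : ℝ) + 1) * t⌋₊ : ℝ) / (k + 1) ≤ t := fun k => by
    rw [div_le_iff₀ (hk0 k), mul_comm t]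
    exact Nat.floor_le (mul_nonneg (hk0 k).le ht)
  refine ⟨hqt, tendsto_of_tendsto_of_tendsto_of_le_of_le (g := fun k : ℕ => t - 1 / ((k : ℝ) + 1))
    ?_ tendsto_const_nhds (fun k => ?_) hqt⟩
  · simpa using (tendsto_one_div_add_atTop_nhds_zero_nat (𝕜 := ℝ)).const_sub t
  · have := (Nat.lt_floor_add_one (((k : ℝ) + 1) * t)).le
    change t - 1 / ((k : ℝ) + 1) ≤ _
    rw [sub_le_iff_le_add, ← add_div, le_div_iff₀ (hk0 k)]
    linarith

lemma measurable_floor_mul {X : Type*} [MeasurableSpace X] {F : ℕ → ℝ → X}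
    (hF : ∀ n, Measurable (F n)) (c : ℝ) : Measurable fun t => F ⌊c * t⌋₊ t := by
  have h1 : Measurable fun p : ℕ × ℝ => F p.1 p.2 := measurable_from_prod_countable_right hF
  have h2 : Measurable fun t : ℝ => ⌊c * t⌋₊ :=
    Nat.measurable_floor.comp (measurable_const.mul measurable_id)
  exact h1.comp (h2.prodMk measurable_id)

variable {E : Type*} [NormedAddCommGroup E] [NormedSpace ℂ E]
  {M : Type*} [TopologicalSpace M] [ChartedSpace E M] [SecondCountableTopology M] [Nonempty M]
  [IsManifold 𝓘(ℂ, E) ω M] {h : HermitianMetric E M} {φ : ℝ → ℝ → M → M}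
  [FiniteDimensional ℂ E] [T2Space M]

namespace IsEvolutionFamily

/-- In a chart, the generator is holomorphic at regular times, and bounded uniformly in time. -/
lemma exists_transitionDeriv_generator_eq (hφ : IsEvolutionFamily h ∞ φ) (a : M) {T : ℝ}
    (hT : 0 < T) :
    ∃ R > 0, ∃ L > 0, Metric.ball (chartAt E a a) R ⊆ (chartAt E a).target ∧
      ∀ t ≤ T, IsRegularTime E φ t → ∃ g : E → E,
        DifferentiableOn ℂ g (Metric.ball (chartAt E a a) R) ∧
        (∀ x ∈ Metric.ball (chartAt E a a) R, ‖g x‖ ≤ L) ∧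
        ∀ y ∈ (chartAt E a).source, chartAt E a y ∈ Metric.ball (chartAt E a a) R →
          transitionDeriv E y a y (generator (E := E) φ y t) = g (chartAt E a y) := by
  obtain ⟨R, hR, L, hL, hRt, H⟩ := hφ.exists_generator_chart a hT
  refine ⟨R, hR, L, hL, hRt, fun t htT ht => ?_⟩
  obtain ⟨g, hg, hgL, hd⟩ := H t htT ht
  exact ⟨g, hg, hgL, fun y hy hyR => (uniqueDiffWithinAt_Ici t).eq_deriv _
    (hφ.hasDerivWithinAt_generator ht hy) (hd y hy hyR)⟩

lemma mdifferentiable_generator (hφ : IsEvolutionFamily h ∞ φ) (t : ℝ) :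
    MDifferentiable 𝓘(ℂ, E) 𝓘(ℂ, E).tangent
      (fun z => (⟨z, generator φ z t⟩ : TangentBundle 𝓘(ℂ, E) M)) := by
  intro a
  rw [mdifferentiableAt_section]
  by_cases ht : IsRegularTime E φ t
  · obtain ⟨R, hR, _, _, hRt, H⟩ := hφ.exists_transitionDeriv_generator_eq a ht.1
    obtain ⟨g, hg, -, hgen⟩ := H t le_rfl ht
    have hgd : MDifferentiableAt 𝓘(ℂ, E) 𝓘(ℂ, E) (fun y => g (chartAt E a y)) a := by
      have h1 := (hg.differentiableAt (Metric.ball_mem_nhds _ hR)).mdifferentiableAt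
      exact h1.comp a (mdifferentiableAt_atlas (I := 𝓘(ℂ, E)) (chart_mem_atlas E a)
        (mem_chart_source E a))
    refine hgd.congr_of_eventuallyEq ?_
    filter_upwards [eventually_mem_chart_ball (E := E) a hR] with y hy
    rw [← hgen y hy.1 hy.2]
    exact congrArg Prod.snd (trivializationAt_apply_eq_transitionDeriv (E := E) a y _)
  · refine (mdifferentiableAt_const (c := (0 : E))).congr_of_eventuallyEq
      (Eventually.of_forall fun y => ?_)
    have h0 : generator (E := E) φ y t = (0 : E) := if_neg ht
    refine (congrArg Prod.snd
      (trivializationAt_apply_eq_transitionDeriv (E := E) a y (generator φ y t))).trans ?_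
    rw [h0]
    exact map_zero _

lemma exists_norm_generator_le (hφ : IsEvolutionFamily h ∞ φ) {K : Set M} (hK : IsCompact K)
    {T : ℝ} (hT : 0 < T) : ∃ C, 0 ≤ C ∧ ∀ t ≤ T, IsRegularTime E φ t → ∀ z ∈ K,
      h.norm z (generator φ z t) ≤ C := by
  have : ProperSpace E := FiniteDimensional.proper ℂ E
  refine hK.induction_on (p := fun s => ∃ C, 0 ≤ C ∧ ∀ t ≤ T, IsRegularTime E φ t → ∀ z ∈ s,
      h.norm z (generator φ z t) ≤ C) ⟨0, le_rfl, by simp⟩ ?_ ?_ fun a _ => ?_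
  · rintro s s' hss' ⟨C, hC, H⟩
    exact ⟨C, hC, fun t htT ht z hz => H t htT ht z (hss' hz)⟩
  · rintro s s' ⟨C, hC, H⟩ ⟨C', hC', H'⟩
    refine ⟨max C C', le_max_of_le_left hC, fun t htT ht z hz => ?_⟩
    rcases hz with hz | hz
    · exact (H t htT ht z hz).trans (le_max_left _ _)
    · exact (H' t htT ht z hz).trans (le_max_right _ _)
  · obtain ⟨R, hR, L, hL, hRt, H⟩ := hφ.exists_transitionDeriv_generator_eq a hT
    have hcl : Metric.closedBall (chartAt E a a) (R / 2) ⊆ (chartAt E a).target :=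
      (Metric.closedBall_subset_ball (by linarith)).trans hRt
    obtain ⟨_, _, C, hC, hCK⟩ := h.exists_norm_bounds (a := a)
      ((isCompact_closedBall _ _).image_of_continuousOn ((chartAt E a).continuousOn_symm.mono hcl))
      (by rintro _ ⟨x, hx, rfl⟩; exact (chartAt E a).map_target (hcl hx))
    refine ⟨_, mem_nhdsWithin_of_mem_nhds (eventually_mem_chart_ball (E := E) a (half_pos hR)),
      C * L, by positivity, fun t htT ht z hz => ?_⟩
    obtain ⟨g, -, hgL, hgen⟩ := H t htT ht
    have hzR : chartAt E a z ∈ Metric.ball (chartAt E a a) R :=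
      Metric.ball_subset_ball (by linarith) hz.2
    refine (hCK z ⟨_, Metric.ball_subset_closedBall hz.2, (chartAt E a).left_inv hz.1⟩ _).2.trans ?_
    gcongr
    rw [hgen z hz.1 hzR]
    exact hgL _ hzR

/-- The derivative at t of the orbit started at (q k, z) is the generator at φ_{q k,t}(z). This
point tends to z, and the generator is continuous in space. -/
lemma tendsto_deriv_orbit (hφ : IsEvolutionFamily h ∞ φ) {t : ℝ} (ht : IsRegularTime E φ t) (z : M)
    {q : ℕ → ℝ} (hq0 : ∀ k, 0 ≤ q k) (hqt : ∀ k, q k ≤ t) (hq : Tendsto q atTop (𝓝 t))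
    (hd : ∀ k, MDifferentiableAt 𝓘(ℝ, ℝ) 𝓘(ℝ, E) (fun τ => φ (q k) τ z) t) :
    Tendsto (fun k => deriv (fun τ => chartAt E z (φ (q k) τ z)) t) atTop
      (𝓝 (rightVelocity E φ z t)) := by
  have hz := mem_chart_source E z
  obtain ⟨R, hR, _, _, hRt, H⟩ := hφ.exists_transitionDeriv_generator_eq z ht.1
  obtain ⟨g, hg, -, hgen⟩ := H t le_rfl ht
  obtain ⟨R', hR', L, hL, δ, hδ, hRt', hest⟩ := hφ.exists_norm_chart_sub_le z ht.1
  have hlim : Tendsto (fun k => t - q k) atTop (𝓝 0) := by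
    simpa using hq.const_sub t
  have hnear : ∀ᶠ k in atTop, φ (q k) t z ∈ (chartAt E z).source ∧
      ‖chartAt E z (φ (q k) t z) - chartAt E z z‖ ≤ L * (t - q k) := by
    filter_upwards [hlim.eventually (gt_mem_nhds hδ)] with k hk
    exact hest z hz (Metric.mem_ball_self hR') (q k) t (hq0 k) (hqt k) le_rfl hk
  have hψlim : Tendsto (fun k => chartAt E z (φ (q k) t z)) atTop (𝓝 (chartAt E z z)) := by
    rw [tendsto_iff_norm_sub_tendsto_zero]
    refine squeeze_zero' (Eventually.of_forall fun _ => norm_nonneg _) (hnear.mono fun k h => h.2) ?_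
    simpa using hlim.const_mul L
  have hgz : rightVelocity E φ z t = g (chartAt E z z) := by
    have := hgen z hz (Metric.mem_ball_self hR)
    rwa [transitionDeriv_self hz] at this
  have hglim := ((hg.differentiableAt (Metric.ball_mem_nhds _ hR)).continuousAt.tendsto).comp hψlim
  rw [hgz]
  refine hglim.congr' ?_
  filter_upwards [hnear, hψlim.eventually (Metric.ball_mem_nhds _ hR)] with k hk hkR
  obtain ⟨e, he1, he2⟩ := hφ.hasDerivWithinAt_flow_of_mdifferentiableAt (hq0 k) (hqt k)
    (hd k) hk.1
  have he3 := (uniqueDiffWithinAt_Ici t).eq_deriv _ he2 (hφ.hasDerivWithinAt_generator ht hk.1)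
  rw [Function.comp_apply, he1.deriv, he3, hgen _ hk.1 hkR]

lemma aestronglyMeasurable_rightVelocity (hφ : IsEvolutionFamily h ∞ φ) (z : M) :
    AEStronglyMeasurable (fun t => rightVelocity E φ z t) (volume.restrict (Ici 0)) := by
  have : ProperSpace E := FiniteDimensional.proper ℂ E
  borelize E
  let f : ℕ → ℝ → E := fun k t =>
    deriv (fun τ => chartAt E z (φ ((⌊((k : ℝ) + 1) * t⌋₊ : ℝ) / (k + 1)) τ z)) t
  -- The derivative of an arbitrary function into a complete space is measurable, so meaningless
  -- chart values do no harm.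
  have hmeas : ∀ k, Measurable (f k) := fun k =>
    measurable_floor_mul (F := fun n => deriv fun τ => chartAt E z (φ ((n : ℝ) / (k + 1)) τ z))
      (fun n => measurable_deriv _) _
  refine aestronglyMeasurable_of_tendsto_ae (f := f) atTop (fun k => (hmeas k).aestronglyMeasurable) ?_
  -- Regular times say nothing about orbits of the given z, so the null sets of its countably many
  -- grid starting times are discarded too.
  have hd : ∀ k n : ℕ, ∀ᵐ t ∂volume.restrict (Ici (0 : ℝ)), (n : ℝ) / (k + 1) ≤ t →
      MDifferentiableAt 𝓘(ℝ, ℝ) 𝓘(ℝ, E) (fun τ => φ ((n : ℝ) / (k + 1)) τ z) t := fun k n => by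
    refine ae_restrict_of_ae ?_
    filter_upwards [(ae_restrict_iff' measurableSet_Ici).1
      (hφ.ae_mdifferentiableAt (s := (n : ℝ) / (k + 1)) (by positivity) z)] with t ht hnt
    exact (ht hnt).2
  filter_upwards [hφ.ae_isRegularTime, ae_all_iff.2 fun k => ae_all_iff.2 (hd k)] with t ht hdt
  obtain ⟨hqt, hlim⟩ := tendsto_floor_mul_div_add_one ht.1.le
  exact hφ.tendsto_deriv_orbit ht z (fun k => by positivity) hqt hlim fun k => hdt k _ (hqt k)

/-- The generator of an evolution family of order `∞` is a weak holomorphic vector field. -/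
theorem isWeakHolomorphicVectorField_generator (hφ : IsEvolutionFamily h ∞ φ) :
    IsWeakHolomorphicVectorField h ∞ (generator (E := E) φ) where
  measurable := hφ.aestronglyMeasurable_rightVelocity
  holomorphic t _ := hφ.mdifferentiable_generator t
  bound K T hK hT := by
    obtain ⟨C, hC, H⟩ := hφ.exists_norm_generator_le hK hT
    refine ⟨fun _ => C, fun _ _ => hC, memLp_const C, ?_⟩
    filter_upwards [ae_mono (Measure.restrict_mono Icc_subset_Ici_self le_rfl)
      hφ.ae_isRegularTime, ae_restrict_mem measurableSet_Icc] with t ht htT z hz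
    exact H t htT.2 ht z hz

lemma kobayashiDifferential_generator_nonpos [PreconnectedSpace M] (hk : KobayashiC1 E M)
    (hφ : IsEvolutionFamily h ∞ φ) {t : ℝ} (ht : IsRegularTime E φ t) {z w : M} (hzw : z ≠ w) :
    kobayashiDifferential z w (generator (E := E) φ z t) (generator φ w t) ≤ 0 := by
  have hmd : MDifferentiableAt (𝓘(ℝ, E).prod 𝓘(ℝ, E)) 𝓘(ℝ, ℝ)
      (fun p : M × M => kobayashiDist E p.1 p.2) (z, w) :=
    ((hk (z, w) hzw).contMDiffAt (isClosed_diagonal.isOpen_compl.mem_nhds hzw)).mdifferentiableAt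
      one_ne_zero
  have hpt : (φ t t z, φ t t w) = (z, w) := by rw [hφ.refl t ht.1.le]; rfl
  -- φ t t z equals z only propositionally, so the differential must be transported between base
  -- points.
  have hval : ∀ p p' : M × M, p = p' → ∀ v : E × E,
      (mfderiv (𝓘(ℝ, E).prod 𝓘(ℝ, E)) 𝓘(ℝ, ℝ) (fun p : M × M => kobayashiDist E p.1 p.2) p v : ℝ) =
        mfderiv (𝓘(ℝ, E).prod 𝓘(ℝ, E)) 𝓘(ℝ, ℝ) (fun p : M × M => kobayashiDist E p.1 p.2) p' v := by
    rintro p _ rfl v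
    rfl
  have hcomp := HasMFDerivAt.comp_hasMFDerivWithinAt t
    (show MDifferentiableAt (𝓘(ℝ, E).prod 𝓘(ℝ, E)) 𝓘(ℝ, ℝ)
      (fun p : M × M => kobayashiDist E p.1 p.2) (φ t t z, φ t t w) from
        hpt.symm ▸ hmd).hasMFDerivAt
    ((hφ.hasMFDerivWithinAt_generator ht z).prodMk (hφ.hasMFDerivWithinAt_generator ht w))
  have hderiv : HasDerivWithinAt (fun τ => kobayashiDist E (φ t τ z) (φ t τ w))
      (kobayashiDifferential z w (generator (E := E) φ z t) (generator φ w t)) (Ici t) t := by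
    obtain ⟨D, hD, hD1⟩ : ∃ D : ℝ →L[ℝ] ℝ,
        HasFDerivWithinAt (fun τ => kobayashiDist E (φ t τ z) (φ t τ w)) D (Ici t) t ∧
          D 1 = kobayashiDifferential z w (generator (E := E) φ z t) (generator φ w t) :=
      ⟨_, hasMFDerivWithinAt_iff_hasFDerivWithinAt.1 hcomp, (hval _ _ hpt _).trans
        (congrArg (mfderiv (𝓘(ℝ, E).prod 𝓘(ℝ, E)) 𝓘(ℝ, ℝ)
          (fun p : M × M => kobayashiDist E p.1 p.2) (z, w))
          (Prod.ext (one_smul ℝ _) (one_smul ℝ _)))⟩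
    exact hD1 ▸ hD.hasDerivWithinAt
  rw [← hasDerivWithinAt_Ioi_iff_Ici, hasDerivWithinAt_iff_tendsto_slope' self_notMem_Ioi] at hderiv
  refine le_of_tendsto hderiv ?_
  filter_upwards [self_mem_nhdsWithin] with τ hτ
  rw [slope_def_field]
  refine div_nonpos_of_nonpos_of_nonneg ?_ (sub_nonneg.2 (mem_Ioi.1 hτ).le)
  have h2 := kobayashiDist_map_le (E := E) (hφ.holomorphic t τ ht.1.le (mem_Ioi.1 hτ).le) z w
  rw [hφ.refl t ht.1.le]
  exact sub_nonpos.2 h2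

theorem isHerglotzVectorField_generator [PreconnectedSpace M] (hk : KobayashiC1 E M)
    (hφ : IsEvolutionFamily h ∞ φ) : IsHerglotzVectorField h ∞ (generator (E := E) φ) where
  toIsWeakHolomorphicVectorField := hφ.isWeakHolomorphicVectorField_generator
  dk_nonpos := hφ.ae_isRegularTime.mono fun _ ht _ _ hzw =>
    hφ.kobayashiDifferential_generator_nonpos hk ht hzw

/-- A weak holomorphic vector field that solves the Loewner equation is the generator. -/
theorem ae_generator_eq (hφ : IsEvolutionFamily h ∞ φ) {d : ℝ≥0∞}
    {H : (z : M) → ℝ → TangentSpace 𝓘(ℂ, E) z} (hH : IsWeakHolomorphicVectorField h d H)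
    (hsol : SolvesLoewner φ H) :
    ∀ᵐ t ∂volume.restrict (Ici (0 : ℝ)), ∀ z : M, generator φ z t = H z t := by
  have hd : ∀ (q : ℚ) (n : ℕ), ∀ᵐ t ∂volume.restrict (Ici (0 : ℝ)), 0 ≤ (q : ℝ) → (q : ℝ) < t →
      HasMFDerivAt 𝓘(ℝ, ℝ) 𝓘(ℝ, E) (fun τ : ℝ => φ q τ (TopologicalSpace.denseSeq M n)) t
        ((1 : ℝ →L[ℝ] ℝ).smulRight
          (toRealTangent (H (φ q t (TopologicalSpace.denseSeq M n)) t))) := by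
    intro q n
    by_cases hq : 0 ≤ (q : ℝ)
    · refine ae_restrict_of_ae ?_
      filter_upwards [(ae_restrict_iff' measurableSet_Ici).1
        (hsol q hq (TopologicalSpace.denseSeq M n))] with t ht _ hqt
      exact ht hqt.le
    · exact ae_of_all _ fun t h => absurd h hq
  filter_upwards [hφ.ae_isRegularTime, ae_all_iff.2 fun q => ae_all_iff.2 (hd q)] with t ht hdt
  have heq : ∀ q : ℚ, 0 ≤ (q : ℝ) → (q : ℝ) < t → ∀ n,
      generator φ (φ q t (TopologicalSpace.denseSeq M n)) t =
        H (φ q t (TopologicalSpace.denseSeq M n)) t := by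
    intro q hq hqt n
    have h1 := (hasMFDerivAt_curve_iff.1
      (hφ.hasMFDerivAt_orbit hq hqt.le ht (ht.2 q hq hqt n))).2
    exact h1.unique (hasMFDerivAt_curve_iff.1 (hdt q n hq hqt)).2
  intro z
  set S : Set M := {y | (generator φ y t : TangentSpace 𝓘(ℂ, E) y) = H y t} with hS
  have hcl : z ∈ closure S := by
    rw [mem_closure_iff_nhds]
    intro U hU
    obtain ⟨q, hq0, hqt, n, hn⟩ := hφ.exists_flow_mem_nhds ht.1 hU
    exact ⟨_, hn, heq q hq0 hqt n⟩
  have : (𝓝[S] z).NeBot := mem_closure_iff_nhdsWithin_neBot.1 hcl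
  -- Vectors at different points are compared in the chart at z, where a holomorphic field has
  -- continuous coordinates.
  have hc : ∀ X : (y : M) → TangentSpace 𝓘(ℂ, E) y, MDifferentiable 𝓘(ℂ, E) 𝓘(ℂ, E).tangent
      (fun y => (⟨y, X y⟩ : TangentBundle 𝓘(ℂ, E) M)) →
      Tendsto (fun y => transitionDeriv E y z y (X y)) (𝓝[S] z) (𝓝 (X z : E)) := by
    intro X hX
    have h1 := ((mdifferentiableAt_section 𝓘(ℂ, E) X).1 (hX z)).continuousAt.tendsto
    have h2 : ∀ y, (trivializationAt E (TangentSpace 𝓘(ℂ, E) (M := M)) z ⟨y, X y⟩).2 =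
        transitionDeriv E y z y (X y) := fun y =>
      congrArg Prod.snd (trivializationAt_apply_eq_transitionDeriv (E := E) z y (X y))
    simp only [h2] at h1
    rw [transitionDeriv_self (mem_chart_source E z)] at h1
    exact h1.mono_left nhdsWithin_le_nhds
  refine tendsto_nhds_unique (X := E) (hc _ (hφ.mdifferentiable_generator t))
    ((hc _ (hH.holomorphic t ht.1.le)).congr' ?_)
  filter_upwards [self_mem_nhdsWithin] with y hy
  exact congrArg _ (Eq.symm hy)

end IsEvolutionFamily

end Herglotz

end Loewner

end

theorem proposition4p1
    {E : Type*} [NormedAddCommGroup E] [NormedSpace ℂ E] [FiniteDimensional ℂ E]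
    {M : Type*} [TopologicalSpace M] [ChartedSpace E M] [IsManifold 𝓘(ℂ, E) ω M]
    [T2Space M] [SecondCountableTopology M] [ConnectedSpace M]
    (h : Loewner.HermitianMetric E M)
    (hM : Loewner.IsTaut E M) (hk : Loewner.KobayashiC1 E M)
    (φ : ℝ → ℝ → M → M) (hφ : Loewner.IsEvolutionFamily h ∞ φ) :
    ∃ G : (z : M) → ℝ → TangentSpace 𝓘(ℂ, E) z,
      Loewner.IsHerglotzVectorField h ∞ G ∧
      Loewner.SolvesLoewner φ G ∧
      ∀ (d : ℝ≥0∞) (H : (z : M) → ℝ → TangentSpace 𝓘(ℂ, E) z), 1 ≤ d →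
        Loewner.IsWeakHolomorphicVectorField h d H → Loewner.SolvesLoewner φ H →
        ∀ᵐ t ∂volume.restrict (Ici (0 : ℝ)), ∀ z : M, G z t = H z t := by
  exact ⟨Loewner.generator φ, hφ.isHerglotzVectorField_generator hk, hφ.solvesLoewner_generator,
    fun _ _ _ hH hsol => hφ.ae_generator_eq hH hsol⟩
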